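/- **Definitions.** An $n$-dimensional orbifold chart $\mathbf U=(\tilde U,G_U,\varphi_U)$ on a space $X$ consists of a connected open set $\tilde U\subset\mathbb R^n$, a finite group $G_U$ acting smoothly and effectively on $\tilde U$, and a continuous $G_U$-invariant map $\varphi_U:\tilde U\to X$ inducing a homeomorphism of $G_U\backslash\tilde U$ onto an open subset $U=\varphi_U(\tilde U)$ of $X$. An embedding $\lambda:\mathbf U\to\mathbf V$ of charts is a smooth embedding $\lambda:\tilde U\to\tilde V$ with $\varphi_V\circ\lambda=\varphi_U$. An orbifold atlas on $X$ is a set $\mathcal U$ of $n$-dimensional charts covering $X$ such that for all $\mathbf U,\mathbf V\in\mathcal U$ and $x\in U\cap V$ there is $\mathbf W\in\mathcal U$ with $x\in W\subset U\cap V$ that embeds into both $\mathbf U$ and $\mathbf V$. Two atlases are equivalent if they are related by the transitive closure of the relation of having a common refinement (a refinement of $\mathcal V$ being an atlas each of whose charts embeds into some chart of $\mathcal V$). An $n$-dimensional effective orbifold $\mathfrak X$ is a paracompact Hausdorff space $X$ with an equivalence class of $n$-dimensional orbifold atlases. Let $\mathcal U$ be an atlas of $\mathfrak X$ and let $g$ be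 a Riemannian metric on $\mathfrak X$, i.e. a smooth $G_U$-invariant Riemannian metric $g_U$ on $\tilde U$ for each $\mathbf U\in\mathcal U$ such that every embedding $\lambda:\mathbf U\to\mathbf V$ of charts of $\mathcal U$ is isometric. Let $\mathrm{Fr}(\tilde U)\subset\tilde U\times(\mathbb R^n)^n$ be the submanifold of pairs $(x,v)$ with $v$ a $g_U$-orthonormal frame at $x$, on which $G_U$ acts by $a(x,v)=(ax,Da_x v)$. The orthonormal frame bundle $\mathrm{Fr}\,\mathfrak X$ is the quotient space of $\bigsqcup_{\mathbf U\in\mathcal U}\mathrm{Fr}(\tilde U)$ by the equivalence relation generated by $(x,v)\sim(\lambda(x),D\lambda_x v)$ for all embeddings $\lambda:\mathbf U\to\mathbf V$ of charts of $\mathcal U$; let $\varphi_U^*:\mathrm{Fr}(\tilde U)\to\mathrm{Fr}\,\mathfrak X$ be the resulting maps. **Proposition.** For every effective orbifold $\mathfrak X$ of dimension $n$, every atlas $\mathcal U$ of $\mathfrak X$ and every Riemannian metric $g$ on $\mathfrak X$ given on $\mathcal U$, the frame bundle $\mathrm{Fr}\,\mathfrak X$ is a manifold. Precisely: 1. $\mathrm{Fr}\,\mathfrak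 X$ with the charts $(\mathrm{Fr}(\tilde U),G_U,\varphi_U^*)$, $\mathbf U\in\mathcal U$, is an effective orbifold (with manifolds as chart domains): it is paracompact and Hausdorff; $G_U$ acts effectively on $\mathrm{Fr}(\tilde U)$; $\varphi_U^*$ induces a homeomorphism of $G_U\backslash\mathrm{Fr}(\tilde U)$ onto an open subset; and every point $q$ of the images of $\varphi_U^*$ and $\varphi_V^*$ lies in the image of some $\varphi_W^*$ that is contained in both of them, where $\mathbf W\in\mathcal U$ embeds into $\mathbf U$ and into $\mathbf V$. 2. In every chart (in particular in the charts of an orthogonal atlas), if $a\in G_U$ fixes a frame $(x,v)\in\mathrm{Fr}(\tilde U)$, then $Da_x=\mathrm{id}$ and $a=1$. 3. The singular set of $\mathrm{Fr}\,\mathfrak X$, i.e. the set of points $q=\varphi_U^*(p)$ such that the isotropy group $(G_U)_p$ is nontrivial, is empty. 4. $\mathrm{Fr}\,\mathfrak X$ has the structure of a smooth manifold of dimension $n+\binom n2$ for which all the maps $\varphi_U^*:\mathrm{Fr}(\tilde U)\to\mathrm{Fr}\,\mathfrak X$ are local diffeomorphisms. -/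

import Mathlib

open Set Topology
open scoped Manifold ContDiff

noncomputable section

universe u

/-- Euclidean `n`-space. -/
abbrev EucSp (n : ℕ) : Type := EuclideanSpace ℝ (Fin n)

/-- The map induced on the orbit space `G \ D` by a `G`-invariant map `f : D → X`. -/
def orbitSpaceMap (G : Type*) {D X : Type*} [Group G] [MulAction G D] (f : D → X)
    (hf : ∀ (a : G) (p : D), f (a • p) = f p) : MulAction.orbitRel.Quotient G D → X :=
  Quotient.lift f (by
    rintro a b ⟨c, rfl⟩
    exact hf c b)

/-! ### Orbifold charts -/

/-- A finite group `G` acting smoothly and effectively (on the left) on a connected open subset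
`dom` of Euclidean `n`-space. Only the values of `act a` on `dom` are meaningful. -/
structure LocalModel (n : ℕ) : Type 1 where
  dom : Set (EucSp n)
  isOpen_dom : IsOpen dom
  isConnected_dom : IsConnected dom
  G : Type
  [group : Group G]
  [finite : Finite G]
  act : G → EucSp n → EucSp n
  act_mapsTo : ∀ a, MapsTo (act a) dom dom
  act_one : ∀ x ∈ dom, act 1 x = x
  act_mul : ∀ a b, ∀ x ∈ dom, act (a * b) x = act a (act b x)
  act_smooth : ∀ a, ContDiffOn ℝ ∞ (act a) dom
  act_effective : ∀ a, (∀ x ∈ dom, act a x = x) → a = 1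

attribute [instance] LocalModel.group LocalModel.finite

/-- The action of the group of a local model on its domain. -/
instance LocalModel.instMulAction {n : ℕ} (U : LocalModel n) : MulAction U.G U.dom where
  smul a x := ⟨U.act a x, U.act_mapsTo a x.2⟩
  one_smul x := Subtype.ext (U.act_one x x.2)
  mul_smul a b x := Subtype.ext (U.act_mul a b x x.2)

/-- An `n`-dimensional orbifold chart on `X`: a local model together with an invariant map
`proj : dom → X` inducing a homeomorphism of the orbit space `G \ dom` onto an open subset
of `X`. -/
structure OrbifoldChart (n : ℕ) (X : Type u) [TopologicalSpace X] : Type (max 1 u) where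
  model : LocalModel n
  proj : model.dom → X
  proj_smul : ∀ (a : model.G) (x : model.dom), proj (a • x) = proj x
  isOpenEmbedding_orbitSpaceMap : IsOpenEmbedding (orbitSpaceMap model.G proj proj_smul)

/-- The domain of a chart. -/
abbrev OrbifoldChart.dom {n : ℕ} {X : Type u} [TopologicalSpace X] (U : OrbifoldChart n X) :
    Set (EucSp n) := U.model.dom

/-- The group of a chart. -/
abbrev OrbifoldChart.G {n : ℕ} {X : Type u} [TopologicalSpace X] (U : OrbifoldChart n X) :
    Type := U.model.G

/-- The action of the group of a chart. -/
abbrev OrbifoldChart.act {n : ℕ} {X : Type u} [TopologicalSpace X] (U : OrbifoldChart n X) :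
    U.G → EucSp n → EucSp n := U.model.act

/-- `f` is an embedding of the chart `U` into the chart `V`: it restricts to a smooth embedding of
the domain of `U` into the domain of `V` (an injective immersion that is a homeomorphism onto its
image) commuting with the chart maps. Only the values of `f` on `U.dom` matter. -/
structure OrbifoldChart.IsEmb {n : ℕ} {X : Type u} [TopologicalSpace X]
    (U V : OrbifoldChart n X) (f : EucSp n → EucSp n) : Prop where
  mapsTo : MapsTo f U.dom V.dom
  smooth : ContDiffOn ℝ ∞ f U.dom
  immersion : ∀ x ∈ U.dom, Function.Injective (fderiv ℝ f x)
  isEmbedding : IsEmbedding (U.dom.domRestrict f)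
  proj_comp : ∀ x : U.dom, V.proj ⟨f x, mapsTo x.2⟩ = U.proj x

/-! ### Orbifold atlases and effective orbifolds -/

/-- An `n`-dimensional orbifold atlas on `X`. -/
structure OrbifoldAtlas (n : ℕ) (X : Type u) [TopologicalSpace X] : Type (max 1 u) where
  charts : Set (OrbifoldChart n X)
  cover : ∀ x : X, ∃ U ∈ charts, x ∈ range U.proj
  compatible : ∀ U ∈ charts, ∀ V ∈ charts, ∀ x ∈ range U.proj ∩ range V.proj,
    ∃ W ∈ charts, x ∈ range W.proj ∧ range W.proj ⊆ range U.proj ∩ range V.proj ∧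
      (∃ f, W.IsEmb U f) ∧ (∃ f, W.IsEmb V f)

/-- `𝒰` is a refinement of `𝒱`. -/
def OrbifoldAtlas.Refines {n : ℕ} {X : Type u} [TopologicalSpace X]
    (𝒰 𝒱 : OrbifoldAtlas n X) : Prop :=
  ∃ r : 𝒰.charts → 𝒱.charts, ∀ U : 𝒰.charts, ∃ f, U.1.IsEmb (r U).1 f

/-- `𝒰` and `𝒱` have a common refinement. -/
def OrbifoldAtlas.HasCommonRefinement {n : ℕ} {X : Type u} [TopologicalSpace X]
    (𝒰 𝒱 : OrbifoldAtlas n X) : Prop :=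
  ∃ 𝒲 : OrbifoldAtlas n X, 𝒲.Refines 𝒰 ∧ 𝒲.Refines 𝒱

/-- An orbifold structure: a class of atlases for the equivalence relation generated by having a
common refinement. -/
def OrbifoldStructure (n : ℕ) (X : Type u) [TopologicalSpace X] : Type (max 1 u) :=
  Quot (OrbifoldAtlas.HasCommonRefinement (n := n) (X := X))

/-- The orbifold structure of an atlas. -/
def OrbifoldAtlas.toStructure {n : ℕ} {X : Type u} [TopologicalSpace X]
    (𝒰 : OrbifoldAtlas n X) : OrbifoldStructure n X :=
  Quot.mk _ 𝒰

/-- An `n`-dimensional effective orbifold: a paracompact Hausdorff space with an orbifold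
structure. -/
structure EffectiveOrbifold (n : ℕ) : Type (max 1 (u + 1)) where
  space : Type u
  [topologicalSpace : TopologicalSpace space]
  [t2Space : T2Space space]
  [paracompactSpace : ParacompactSpace space]
  str : OrbifoldStructure n space

attribute [instance] EffectiveOrbifold.topologicalSpace EffectiveOrbifold.t2Space
  EffectiveOrbifold.paracompactSpace

/-- A Riemannian metric on an orbifold, given in the charts of an atlas: a smooth Riemannian metric
on the domain of each chart, invariant under the group of the chart and compatible with all
embeddings between charts of the atlas. -/
structure OrbifoldMetric {n : ℕ} {X : Type u} [TopologicalSpace X] (𝒰 : OrbifoldAtlas n X) where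
  form : 𝒰.charts → EucSp n → EucSp n →L[ℝ] EucSp n →L[ℝ] ℝ
  smooth : ∀ U, ContDiffOn ℝ ∞ (form U) U.1.dom
  symm : ∀ U, ∀ x ∈ U.1.dom, ∀ v w, form U x v w = form U x w v
  pos : ∀ U, ∀ x ∈ U.1.dom, ∀ v, v ≠ 0 → 0 < form U x v v
  invariant : ∀ U, ∀ a : U.1.G, ∀ x ∈ U.1.dom, ∀ v w,
    form U (U.1.act a x) (fderiv ℝ (U.1.act a) x v) (fderiv ℝ (U.1.act a) x w) = form U x v w
  compatible : ∀ U V, ∀ f, U.1.IsEmb V.1 f → ∀ x ∈ U.1.dom, ∀ v w,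
    form V (f x) (fderiv ℝ f x v) (fderiv ℝ f x w) = form U x v w

/-! ### Derivatives of the action -/

theorem LocalModel.differentiableAt_act {n : ℕ} (U : LocalModel n) (a : U.G) {x : EucSp n}
    (hx : x ∈ U.dom) : DifferentiableAt ℝ (U.act a) x :=
  ((U.act_smooth a).contDiffAt (U.isOpen_dom.mem_nhds hx)).differentiableAt (by simp)

theorem LocalModel.fderiv_act_one {n : ℕ} (U : LocalModel n) {x : EucSp n} (hx : x ∈ U.dom) :
    fderiv ℝ (U.act 1) x = ContinuousLinearMap.id ℝ (EucSp n) := by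
  have h : U.act 1 =ᶠ[𝓝 x] id := by
    filter_upwards [U.isOpen_dom.mem_nhds hx] with y hy using U.act_one y hy
  rw [h.fderiv_eq, fderiv_id]

theorem LocalModel.fderiv_act_mul {n : ℕ} (U : LocalModel n) (a b : U.G) {x : EucSp n}
    (hx : x ∈ U.dom) :
    fderiv ℝ (U.act (a * b)) x = (fderiv ℝ (U.act a) (U.act b x)).comp (fderiv ℝ (U.act b) x) := by
  have h : U.act (a * b) =ᶠ[𝓝 x] U.act a ∘ U.act b := by
    filter_upwards [U.isOpen_dom.mem_nhds hx] with y hy using U.act_mul a b y hy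
  rw [h.fderiv_eq]
  exact fderiv_comp x (U.differentiableAt_act a (U.act_mapsTo b hx)) (U.differentiableAt_act b hx)

/-- Every element of the group of a chart is an embedding of the chart into itself. -/
theorem OrbifoldChart.isEmb_act {n : ℕ} {X : Type u} [TopologicalSpace X]
    (U : OrbifoldChart n X) (a : U.G) : U.IsEmb U (U.act a) where
  mapsTo := U.model.act_mapsTo a
  smooth := U.model.act_smooth a
  immersion x hx v w hvw := by
    have h := U.model.fderiv_act_mul a⁻¹ a hx
    rw [inv_mul_cancel, U.model.fderiv_act_one hx] at h
    have hv := DFunLike.congr_fun h v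
    have hw := DFunLike.congr_fun h w
    simp only [ContinuousLinearMap.comp_apply, ContinuousLinearMap.id_apply] at hv hw
    rw [hv, hw, hvw]
  isEmbedding := by
    have hc (b : U.G) : Continuous (fun x : U.dom => b • x) :=
      Continuous.subtype_mk ((U.model.act_smooth b).continuousOn.domRestrict) _
    have h : IsHomeomorph (fun x : U.dom => a • x) :=
      (Homeomorph.mk (MulAction.toPerm a) (hc a) (hc a⁻¹)).isHomeomorph
    exact IsEmbedding.subtypeVal.comp h.isEmbedding
  proj_comp x := U.proj_smul a x

/-! ### The orthonormal frame bundle -/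

namespace OrbifoldMetric

variable {n : ℕ} {X : Type u} [TopologicalSpace X] {𝒰 : OrbifoldAtlas n X}

/-- The orthonormal frames over the domain of a chart: the pairs `(x, v)` of a point `x` of the
domain and a basis `v` of the tangent space at `x`, orthonormal for the metric of the chart.
It carries the subspace topology. -/
def frames (g : OrbifoldMetric 𝒰) (U : 𝒰.charts) : Set (EucSp n × (Fin n → EucSp n)) :=
  {p | p.1 ∈ U.1.dom ∧ ∀ i j, g.form U p.1 (p.2 i) (p.2 j) = if i = j then 1 else 0}

/-- The group of a chart acts on the orthonormal frames by `a (x, v) = (a x, Da_x v)`. -/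
instance instMulActionFrames (g : OrbifoldMetric 𝒰) (U : 𝒰.charts) :
    MulAction U.1.G (g.frames U) where
  smul a p := ⟨(U.1.act a p.1.1, fun i => fderiv ℝ (U.1.act a) p.1.1 (p.1.2 i)),
    U.1.model.act_mapsTo a p.2.1, fun i j => by
      rw [g.invariant U a _ p.2.1]
      exact p.2.2 i j⟩
  one_smul p := by
    refine Subtype.ext (Prod.ext (U.1.model.act_one _ p.2.1) (funext fun i => ?_))
    change fderiv ℝ (U.1.act 1) p.1.1 (p.1.2 i) = p.1.2 i
    rw [U.1.model.fderiv_act_one p.2.1]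
    rfl
  mul_smul a b p := by
    refine Subtype.ext (Prod.ext (U.1.model.act_mul a b _ p.2.1) (funext fun i => ?_))
    change fderiv ℝ (U.1.act (a * b)) p.1.1 (p.1.2 i) = _
    rw [U.1.model.fderiv_act_mul a b p.2.1]
    rfl

/-- The gluing relation: a frame `(x, v)` over the chart `U` is identified with the frame
`(f x, Df_x v)` over the chart `V` whenever `f` is an embedding of `U` into `V`. -/
def Glue (g : OrbifoldMetric 𝒰) (p q : Σ U : 𝒰.charts, g.frames U) : Prop :=
  ∃ f, p.1.1.IsEmb q.1.1 f ∧ q.2.1.1 = f p.2.1.1 ∧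
    ∀ i, q.2.1.2 i = fderiv ℝ f p.2.1.1 (p.2.1.2 i)

/-- The total space of the orthonormal frame bundle: the quotient space of the disjoint union of
the spaces of orthonormal frames over the charts by the equivalence relation generated by gluing
along embeddings. -/
def FrameBundle (g : OrbifoldMetric 𝒰) : Type (max 1 u) := Quot g.Glue

instance instTopologicalSpaceFrameBundle (g : OrbifoldMetric 𝒰) :
    TopologicalSpace g.FrameBundle :=
  inferInstanceAs (TopologicalSpace (Quot g.Glue))

/-- The chart map of the frame bundle belonging to the chart `U`. -/
def frameProj (g : OrbifoldMetric 𝒰) (U : 𝒰.charts) : g.frames U → g.FrameBundle :=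
  fun p => Quot.mk g.Glue ⟨U, p⟩

theorem frameProj_smul (g : OrbifoldMetric 𝒰) (U : 𝒰.charts) (a : U.1.G) (p : g.frames U) :
    g.frameProj U (a • p) = g.frameProj U p :=
  (Quot.sound ⟨U.1.act a, U.1.isEmb_act a, rfl, fun _ => rfl⟩).symm

/-- The singular set of the frame bundle with its charts `(frames U, U.G, frameProj U)`: the points
with nontrivial local group, the local group being the isotropy group of a point of a chart
lying above the given point. -/
def frameSingularSet (g : OrbifoldMetric 𝒰) : Set g.FrameBundle :=
  {q | ∃ (U : 𝒰.charts) (p : g.frames U), g.frameProj U p = q ∧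
    MulAction.stabilizer U.1.G p ≠ ⊥}

end OrbifoldMetric

/-- `f : S → M`, from a subset `S` of a normed space `F` to a smooth `d`-manifold `M`, is a local
diffeomorphism at `p`: near `p` it is a homeomorphism onto an open subset of `M` whose inverse is a
smooth immersion into `F`. (So near `p` the set `S` is a `d`-dimensional embedded submanifold of
`F`, and `f` is a diffeomorphism for the submanifold structure.) -/
def IsSubmanifoldLocalDiffeoAt {F : Type*} [NormedAddCommGroup F] [NormedSpace ℝ F] {S : Set F}
    (d : ℕ) {M : Type*} [TopologicalSpace M] [ChartedSpace (EucSp d) M] (f : S → M) (p : S) :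
    Prop :=
  ∃ e : OpenPartialHomeomorph S M, p ∈ e.source ∧ EqOn e f e.source ∧
    ContMDiffOn (𝓡 d) 𝓘(ℝ, F) ∞ (fun y => (e.symm y : F)) e.target ∧
    ∀ y ∈ e.target,
      Function.Injective (mfderiv (𝓡 d) 𝓘(ℝ, F) (fun z => (e.symm z : F)) y)

end

noncomputable section

/-! ### Rigidity of maps that agree up to a finite group -/

/-! An isometry is determined locally by its 1-jet, so a group element fixing an orthonormal frame
should be trivial. Hence each chart group acts freely on the frames, and since the groups are
finite, the quotients are manifolds. Rigidity of 1-jets is all that is needed, and the proof obtains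
it without geodesics, from finiteness of the groups alone.

Let two maps into a chart agree pointwise up to its group and have the same invertible 1-jet at one
point. Averaging over the isotropy group of the image point gives coordinates in which that group
acts linearly; there, difference quotients along rays take only finitely many values, and continuity
forces the maps to agree near the point (`eventuallyEq_of_jet_eq`). An open-closed argument spreads
this over connected domains (`eqOn_of_jet_eq`). It gives freeness on frames (`eq_one_of_smul_eq`).
With Baire's theorem it also shows that maps agreeing pointwise up to the group differ by a single
element (`exists_eqOn_act`).

The gluing relation is only generated by embeddings. It becomes tractable through local lifts of the
identity, which are closed under inverse and composition: two frames are identified exactly when a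
lift carries one to the other (`frameProj_eq_frameProj_iff`). A lift from a chart to itself is
locally a group element, so identified frames over one chart lie in one orbit
(`exists_smul_eq_of_frameProj_eq`).

The Hausdorff property and paracompactness come from the base: fibres reduce to separating orbits of
a finite group, and frames over a compact set are compact. For the smooth structure, the frames over
a chart are a regular level set of the Gram map, and freeness makes the quotient map a local
homeomorphism. -/

/-- If `f` and `m` have the same invertible derivative at a common zero `x₀` and, near `x₀`, `m` is
obtained from `f` by applying pointwise one of finitely many linear maps, then `f = m` near `x₀`. -/
theorem eventuallyEq_of_forall_exists_clm {E F : Type*} [NormedAddCommGroup E] [NormedSpace ℝ E]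
    [CompleteSpace E] [NormedAddCommGroup F] [NormedSpace ℝ F] {f m : E → F} {L : E ≃L[ℝ] F}
    {x₀ : E} (hf : HasStrictFDerivAt f (L : E →L[ℝ] F) x₀)
    (hm : HasFDerivAt m (L : E →L[ℝ] F) x₀) (hmc : ∀ᶠ x in 𝓝 x₀, ContinuousAt m x)
    (f0 : f x₀ = 0) (m0 : m x₀ = 0) {ι : Type*} [Finite ι] (A : ι → F →L[ℝ] F)
    (h : ∀ᶠ x in 𝓝 x₀, ∃ i, m x = A i (f x)) : f =ᶠ[𝓝 x₀] m := by
  set e := hf.toOpenPartialHomeomorph f with he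
  have hef : ∀ x, e x = f x := fun x => rfl
  have hx₀ : x₀ ∈ e.source := hf.mem_toOpenPartialHomeomorph_source
  have h0 : (0 : F) ∈ e.target := by
    have := e.map_source hx₀
    rwa [hef, f0] at this
  have hK0 : e.symm 0 = x₀ := by
    have := e.left_inv hx₀
    rwa [hef, f0] at this
  have hKt : Filter.Tendsto e.symm (𝓝 0) (𝓝 x₀) := by
    have := (e.continuousAt_symm h0).tendsto
    rwa [hK0] at this
  have hKd : HasFDerivAt e.symm (L.symm : F →L[ℝ] E) 0 := by
    have := hf.to_localInverse
    rw [f0] at this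
    exact this.hasFDerivAt
  have hev : ∀ᶠ z in 𝓝 (0 : F), z ∈ e.target ∧ ContinuousAt m (e.symm z) ∧
      ∃ i, m (e.symm z) = A i (f (e.symm z)) :=
    Filter.Eventually.and (e.open_target.mem_nhds h0)
      ((hKt.eventually hmc).and (hKt.eventually h))
  obtain ⟨r, hr, hball⟩ := Metric.eventually_nhds_iff_ball.1 hev
  -- With `N = m ∘ f⁻¹`, each `N (t • z)` equals `A i (t • z)` for some `i` depending on `t`. So
  -- `t⁻¹ • N (t • z)` stays in the finite set of the `A i z`; being continuous on an interval it is
  -- constant, and its limit at `0` is the derivative `DN₀ z = z`.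
  have key : ∀ z ∈ Metric.ball (0 : F) r, m (e.symm z) = z := by
    intro z hz
    set N : F → F := fun w => m (e.symm w) with hN
    have hN0 : N 0 = 0 := by simp [hN, hK0, m0]
    have hND : HasFDerivAt N (ContinuousLinearMap.id ℝ F) 0 := by
      have hm' : HasFDerivAt m (L : E →L[ℝ] F) (e.symm 0) := by rwa [hK0]
      have := hm'.comp (0 : F) hKd
      rwa [ContinuousLinearEquiv.coe_comp_coe_symm] at this
    have hline : HasDerivAt (fun t : ℝ => N (t • z)) z 0 := by
      have h1 : HasDerivAt (fun t : ℝ => t • z) z 0 := by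
        simpa using (hasDerivAt_id (0 : ℝ)).smul_const z
      have h2 : HasFDerivAt N (ContinuousLinearMap.id ℝ F) ((0 : ℝ) • z) := by rwa [zero_smul]
      exact h2.comp_hasDerivAt (0 : ℝ) h1
    have hlim := hline.tendsto_slope_zero_right
    simp only [zero_add, zero_smul, hN0, sub_zero] at hlim
    have hmem : ∀ t ∈ Ioc (0 : ℝ) 1, t • z ∈ Metric.ball (0 : F) r := by
      intro t ht
      rw [mem_ball_zero_iff] at hz ⊢
      rw [norm_smul, Real.norm_of_nonneg ht.1.le]
      exact (mul_le_of_le_one_left (norm_nonneg _) ht.2).trans_lt hz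
    have hcont : ContinuousOn (fun t : ℝ => t⁻¹ • N (t • z)) (Ioc 0 1) := by
      intro t ht
      obtain ⟨h1, h2, -⟩ := hball _ (hmem t ht)
      have h3 : ContinuousAt N (t • z) := ContinuousAt.comp h2 (e.continuousAt_symm h1)
      have h4 : ContinuousAt (fun s : ℝ => N (s • z)) t :=
        ContinuousAt.comp (g := N) h3 (by fun_prop)
      exact ((continuousAt_inv₀ ht.1.ne').smul h4).continuousWithinAt
    have hfin : (range fun i => A i z).Finite := finite_range _
    have hsub : ((fun t : ℝ => t⁻¹ • N (t • z)) '' Ioc 0 1).Subsingleton := by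
      refine hfin.countable.isTotallyDisconnected _ ?_ (isPreconnected_Ioc.image _ hcont)
      rintro _ ⟨t, ht, rfl⟩
      obtain ⟨h1, -, i, hi⟩ := hball _ (hmem t ht)
      refine ⟨i, ?_⟩
      have h5 : f (e.symm (t • z)) = t • z := e.right_inv h1
      simp only [hN, hi, h5, map_smul]
      rw [inv_smul_smul₀ ht.1.ne']
    have hconst : ∀ t ∈ Ioc (0 : ℝ) 1, t⁻¹ • N (t • z) = N z := fun t ht => by
      have := hsub ⟨t, ht, rfl⟩ ⟨1, ⟨one_pos, le_rfl⟩, rfl⟩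
      simpa using this
    refine tendsto_nhds_unique (Filter.Tendsto.congr' ?_ tendsto_const_nhds) hlim
    filter_upwards [Ioc_mem_nhdsGT one_pos] with t ht using (hconst t ht).symm
  have hft : Filter.Tendsto f (𝓝 x₀) (𝓝 0) := by
    simpa [f0] using hf.continuousAt.tendsto
  filter_upwards [e.open_source.mem_nhds hx₀, hft.eventually (Metric.ball_mem_nhds 0 hr)]
    with x hx hxr
  have := key _ hxr
  rw [← hef, e.left_inv hx] at this
  rw [this]; rfl

theorem exists_continuousLinearEquiv_of_injective {n : ℕ} {T : EucSp n →L[ℝ] EucSp n}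
    (hT : Function.Injective T) : ∃ L : EucSp n ≃L[ℝ] EucSp n, (L : EucSp n →L[ℝ] EucSp n) = T :=
  ⟨(LinearEquiv.ofInjectiveEndo (T : EucSp n →ₗ[ℝ] EucSp n) hT).toContinuousLinearEquiv,
    by ext1 x; rfl⟩

/-! ### Linearized isotropy and rigidity of 1-jets in a local model -/

namespace LocalModel

variable {n : ℕ} (U : LocalModel n)

theorem contDiffAt_act (a : U.G) {x : EucSp n} (hx : x ∈ U.dom) : ContDiffAt ℝ ∞ (U.act a) x :=
  (U.act_smooth a).contDiffAt (U.isOpen_dom.mem_nhds hx)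

theorem continuousAt_act (a : U.G) {x : EucSp n} (hx : x ∈ U.dom) : ContinuousAt (U.act a) x :=
  (U.contDiffAt_act a hx).continuousAt

/-- The sum over the stabilizer of `y` of the maps `z ↦ D(b⁻¹)_y (b z)`. Up to a factor this is a
linearization at `y` of the action of the stabilizer. -/
def averagedChart (y : EucSp n) (z : EucSp n) : EucSp n :=
  ∑ᶠ b : {b : U.G // U.act b y = y}, fderiv ℝ (U.act (b : U.G)⁻¹) y (U.act b z)

theorem act_inv_eq {a : U.G} {y : EucSp n} (hy : y ∈ U.dom) (ha : U.act a y = y) :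
    U.act a⁻¹ y = y := by
  have := U.act_mul a⁻¹ a y hy
  rwa [inv_mul_cancel, U.act_one y hy, ha, eq_comm] at this

/-- Right translation `b ↦ b * a` permutes the stabilizer. By the chain rule at the fixed point `y`,
reindexing the sum this way brings `Da_y` out of every term. -/
theorem averagedChart_act {y z : EucSp n} (hy : y ∈ U.dom) (hz : z ∈ U.dom) {a : U.G}
    (ha : U.act a y = y) :
    U.averagedChart y (U.act a z) = fderiv ℝ (U.act a) y (U.averagedChart y z) := by
  have hmul : ∀ b c : U.G, U.act b y = y → U.act c y = y → U.act (b * c) y = y :=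
    fun b c hb hc => by rw [U.act_mul b c y hy, hc, hb]
  unfold averagedChart
  let σ : {b : U.G // U.act b y = y} ≃ {b : U.G // U.act b y = y} :=
    { toFun := fun b => ⟨b * a, hmul _ _ b.2 ha⟩
      invFun := fun b => ⟨b * a⁻¹, hmul _ _ b.2 (U.act_inv_eq hy ha)⟩
      left_inv := fun b => by simp
      right_inv := fun b => by simp }
  have hfin : ∀ f : {b : U.G // U.act b y = y} → EucSp n, (Function.support f).Finite :=
    fun f => toFinite _
  rw [show fderiv ℝ (U.act a) y (∑ᶠ b : {b : U.G // U.act b y = y},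
      fderiv ℝ (U.act (b : U.G)⁻¹) y (U.act b z)) = ∑ᶠ b : {b : U.G // U.act b y = y},
      fderiv ℝ (U.act a) y (fderiv ℝ (U.act (b : U.G)⁻¹) y (U.act b z)) from
      AddMonoidHom.map_finsum (fderiv ℝ (U.act a) y).toLinearMap.toAddMonoidHom (hfin _)]
  rw [← finsum_comp_equiv σ
    (f := fun b => fderiv ℝ (U.act a) y (fderiv ℝ (U.act (b : U.G)⁻¹) y (U.act b z)))]
  refine finsum_congr fun b => ?_
  have h1 : ((σ b : U.G))⁻¹ = a⁻¹ * (b : U.G)⁻¹ := mul_inv_rev _ _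
  have h2 : fderiv ℝ (U.act (a * ((σ b : U.G))⁻¹)) y =
      (fderiv ℝ (U.act a) y).comp (fderiv ℝ (U.act ((σ b : U.G))⁻¹) y) := by
    rw [U.fderiv_act_mul a _ hy, U.act_inv_eq hy (σ b).2]
  rw [← ContinuousLinearMap.comp_apply, ← h2, h1, mul_inv_cancel_left]
  congr 1
  exact (U.act_mul _ _ z hz).symm

theorem contDiffAt_averagedChart {y z : EucSp n} (hz : z ∈ U.dom) :
    ContDiffAt ℝ ∞ (U.averagedChart y) z := by
  have := Fintype.ofFinite {b : U.G // U.act b y = y}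
  have h : U.averagedChart y = fun z => ∑ b : {b : U.G // U.act b y = y},
      fderiv ℝ (U.act (b : U.G)⁻¹) y (U.act b z) :=
    funext fun z => finsum_eq_sum_of_fintype _
  rw [h]
  exact ContDiffAt.sum fun b _ =>
    (fderiv ℝ (U.act (b : U.G)⁻¹) y).contDiff.contDiffAt.comp z (U.contDiffAt_act b hz)

/-- Each summand has derivative `D(b⁻¹)_y ∘ Db_y = id`. In particular the derivative is invertible,
so the averaged map is a local coordinate at `y`. -/
theorem fderiv_averagedChart {y : EucSp n} (hy : y ∈ U.dom) :
    fderiv ℝ (U.averagedChart y) y =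
      (Nat.card {b : U.G // U.act b y = y} : ℝ) • ContinuousLinearMap.id ℝ (EucSp n) := by
  have := Fintype.ofFinite {b : U.G // U.act b y = y}
  have h : U.averagedChart y = fun z => ∑ b : {b : U.G // U.act b y = y},
      fderiv ℝ (U.act (b : U.G)⁻¹) y (U.act b z) :=
    funext fun z => finsum_eq_sum_of_fintype _
  rw [h]
  refine HasFDerivAt.fderiv ?_
  have hsum : HasFDerivAt (fun z => ∑ b : {b : U.G // U.act b y = y},
      fderiv ℝ (U.act (b : U.G)⁻¹) y (U.act b z))
      (∑ b : {b : U.G // U.act b y = y},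
        (fderiv ℝ (U.act (b : U.G)⁻¹) y).comp (fderiv ℝ (U.act b) y)) y :=
    HasFDerivAt.fun_sum fun b _ => (fderiv ℝ (U.act (b : U.G)⁻¹) y).hasFDerivAt.comp y
      (U.differentiableAt_act b hy).hasFDerivAt
  convert hsum using 1
  have : ∀ b : {b : U.G // U.act b y = y},
      (fderiv ℝ (U.act (b : U.G)⁻¹) y).comp (fderiv ℝ (U.act b) y) =
        ContinuousLinearMap.id ℝ (EucSp n) := fun b => by
    have := U.fderiv_act_mul (b : U.G)⁻¹ b hy
    rw [inv_mul_cancel, U.fderiv_act_one hy, b.2] at this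
    exact this.symm
  rw [Finset.sum_congr rfl fun b _ => this b, Finset.sum_const, Nat.card_eq_fintype_card,
    Finset.card_univ]
  exact Nat.cast_smul_eq_nsmul ℝ _ (ContinuousLinearMap.id ℝ (EucSp n))

/-- Two maps into a local model that agree up to the action of the group agree near every point at
which they have the same invertible `1`-jet. -/
theorem eventuallyEq_of_jet_eq {f m : EucSp n → EucSp n} {x₀ : EucSp n}
    (hf : ContDiffAt ℝ ∞ f x₀) (hm : ContDiffAt ℝ ∞ m x₀) (hU : f x₀ ∈ U.dom)
    (h0 : m x₀ = f x₀) (h1 : fderiv ℝ m x₀ = fderiv ℝ f x₀)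
    (hinj : Function.Injective (fderiv ℝ f x₀))
    (h : ∀ᶠ x in 𝓝 x₀, ∃ a, m x = U.act a (f x)) : m =ᶠ[𝓝 x₀] f := by
  set y := f x₀ with hy
  set h' := U.averagedChart y with hh'
  set c : ℝ := (Nat.card {b : U.G // U.act b y = y} : ℝ) with hc
  have hc0 : c ≠ 0 := by
    have : Nonempty {b : U.G // U.act b y = y} := ⟨⟨1, U.act_one y hU⟩⟩
    exact Nat.cast_ne_zero.2 Nat.card_pos.ne'
  have hh'd : HasStrictFDerivAt h' (c • ContinuousLinearMap.id ℝ (EucSp n)) y := by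
    have := (U.contDiffAt_averagedChart (y := y) hU).hasStrictFDerivAt (by simp)
    rwa [U.fderiv_averagedChart hU] at this
  obtain ⟨L, hL⟩ := exists_continuousLinearEquiv_of_injective hinj
  obtain ⟨C, hC⟩ := exists_continuousLinearEquiv_of_injective
    (T := c • ContinuousLinearMap.id ℝ (EucSp n)) (smul_right_injective _ hc0)
  rw [← hC] at hh'd
  have hfd : HasStrictFDerivAt f (L : EucSp n →L[ℝ] EucSp n) x₀ := by
    rw [hL]; exact hf.hasStrictFDerivAt (by simp)
  have hmd : HasFDerivAt m (L : EucSp n →L[ℝ] EucSp n) x₀ := by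
    rw [hL, ← h1]; exact (hm.differentiableAt (by simp)).hasFDerivAt
  have hmh : HasFDerivAt h' (C : EucSp n →L[ℝ] EucSp n) (m x₀) := by
    rw [h0]; exact hh'd.hasFDerivAt
  have hmU : m x₀ ∈ U.dom := h0 ▸ hU
  have hmc : ∀ᶠ x in 𝓝 x₀, ContinuousAt m x := by
    have := (hm.of_le (m := 1) (by simp)).eventually (by simp)
    exact this.mono fun x hx => hx.continuousAt
  -- Elements moving `y` cannot relate `f` to `m` near `x₀`, since `m x₀ = y`. Only the stabilizer
  -- remains, and it acts linearly through the averaged chart.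
  have hfin : ∀ᶠ x in 𝓝 x₀, ∀ a : U.G, U.act a y ≠ y → m x ≠ U.act a (f x) := by
    rw [Filter.eventually_all]
    intro a
    by_cases ha : U.act a y = y
    · exact Filter.Eventually.of_forall fun x hx => absurd ha hx
    · have hne : m x₀ ≠ U.act a (f x₀) := by rw [h0]; exact fun hh => ha hh.symm
      have hca : ContinuousAt (fun x => U.act a (f x)) x₀ :=
        ContinuousAt.comp (g := U.act a) (U.continuousAt_act a hU) hf.continuousAt
      exact (hm.continuousAt.ne_iff_eventually_ne hca |>.1 hne).mono fun x hx _ => hx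
  have hfU : ∀ᶠ x in 𝓝 x₀, f x ∈ U.dom := hf.continuousAt.eventually (U.isOpen_dom.mem_nhds hU)
  have key := eventuallyEq_of_forall_exists_clm (L := L.trans C) (x₀ := x₀)
    (f := fun x => h' (f x) - h' y) (m := fun x => h' (m x) - h' y)
    ((HasStrictFDerivAt.comp x₀ hh'd hfd).sub_const _) ((hmh.comp x₀ hmd).sub_const _)
    (by
      filter_upwards [hmc, hm.continuousAt.eventually (U.isOpen_dom.mem_nhds hmU)] with x hx hxU
      exact (ContinuousAt.comp (g := h') (U.contDiffAt_averagedChart hxU).continuousAt hx).sub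
        continuousAt_const)
    (sub_self _) (by simp [h0]) (fun a : {a : U.G // U.act a y = y} => fderiv ℝ (U.act a) y)
    (by
      filter_upwards [h, hfin, hfU] with x ⟨a, ha⟩ hx hxU
      have hay : U.act a y = y := by
        by_contra hne
        exact hx a hne ha
      refine ⟨⟨a, hay⟩, ?_⟩
      rw [map_sub, ha, hh', U.averagedChart_act hU hxU hay, ← U.averagedChart_act hU hU hay, hay])
  have hli := hh'd.eventually_left_inverse
  have hlim := hm.continuousAt.tendsto
  rw [h0] at hlim
  filter_upwards [key, hf.continuousAt.tendsto.eventually hli, hlim.eventually hli]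
    with x hx hx1 hx2
  have : h' (f x) = h' (m x) := sub_left_injective hx
  rw [← hx1, ← hx2, this]

/-- Two smooth maps from a connected open set into a local model that agree up to the action of the
group are equal if they have the same `1`-jet at one point. -/
theorem eqOn_of_jet_eq {D : Set (EucSp n)} (hD : IsOpen D) (hDc : IsPreconnected D)
    {f m : EucSp n → EucSp n} (hf : ContDiffOn ℝ ∞ f D) (hm : ContDiffOn ℝ ∞ m D)
    (hU : MapsTo f D U.dom) (hinj : ∀ x ∈ D, Function.Injective (fderiv ℝ f x))
    (h : ∀ x ∈ D, ∃ a, m x = U.act a (f x)) {x₀ : EucSp n} (hx₀ : x₀ ∈ D)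
    (h0 : m x₀ = f x₀) (h1 : fderiv ℝ m x₀ = fderiv ℝ f x₀) : EqOn m f D := by
  have hloc : ∀ x ∈ D, m x = f x → fderiv ℝ m x = fderiv ℝ f x → m =ᶠ[𝓝 x] f := fun x hx e0 e1 =>
    U.eventuallyEq_of_jet_eq (hf.contDiffAt (hD.mem_nhds hx)) (hm.contDiffAt (hD.mem_nhds hx))
      (hU hx) e0 e1 (hinj x hx) (Filter.eventually_of_mem (hD.mem_nhds hx) h)
  -- The set of local agreement is open. At a limit point in `D` the 1-jets agree by continuity, so
  -- the local statement applies there again.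
  have hsub : D ⊆ {x | m =ᶠ[𝓝 x] f} := by
    refine hDc.subset_of_closure_inter_subset isOpen_setOfPred_eventually_nhds
      ⟨x₀, hx₀, hloc x₀ hx₀ h0 h1⟩ ?_
    rintro x ⟨hxc, hxD⟩
    have hfr := mem_closure_iff_frequently.1 hxc
    have hc1 : ∀ k : EucSp n → EucSp n, ContDiffOn ℝ ∞ k D → ContinuousAt (fderiv ℝ k) x :=
      fun k hk => (hk.continuousOn_fderiv_of_isOpen hD (by simp)).continuousAt (hD.mem_nhds hxD)
    refine hloc x hxD ?_ ?_
    · exact tendsto_nhds_unique_of_frequently_eq (hm.contDiffAt (hD.mem_nhds hxD)).continuousAt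
        (hf.contDiffAt (hD.mem_nhds hxD)).continuousAt (hfr.mono fun z hz => hz.self_of_nhds)
    · exact tendsto_nhds_unique_of_frequently_eq (hc1 m hm) (hc1 f hf)
        (hfr.mono fun z hz => Filter.EventuallyEq.fderiv_eq hz)
  exact fun x hx => (hsub hx).self_of_nhds

theorem injective_fderiv_act (a : U.G) {x : EucSp n} (hx : x ∈ U.dom) :
    Function.Injective (fderiv ℝ (U.act a) x) := by
  intro v w hvw
  have h := U.fderiv_act_mul a⁻¹ a hx
  rw [inv_mul_cancel, U.fderiv_act_one hx] at h
  have hv := DFunLike.congr_fun h v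
  have hw := DFunLike.congr_fun h w
  simp only [ContinuousLinearMap.comp_apply, ContinuousLinearMap.id_apply] at hv hw
  rw [hv, hw, hvw]

/-- An element of the group with trivial `1`-jet at a point is trivial. -/
theorem eq_one_of_jet_eq {a : U.G} {x : EucSp n} (hx : x ∈ U.dom) (h0 : U.act a x = x)
    (h1 : fderiv ℝ (U.act a) x = ContinuousLinearMap.id ℝ (EucSp n)) : a = 1 := by
  refine U.act_effective a fun z hz => ?_
  refine U.eqOn_of_jet_eq (f := id) U.isOpen_dom U.isConnected_dom.isPreconnected
    contDiff_id.contDiffOn (U.act_smooth a) (mapsTo_id _) ?_ (fun x _ => ⟨a, rfl⟩) hx h0 ?_ hz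
  · intro x _
    rw [fderiv_id]
    exact Function.injective_id
  · rw [h1, fderiv_id]

/-- Two immersions of a connected open set into a local model that agree pointwise up to the
action of the group differ by a single element of the group. -/
theorem exists_eqOn_act {D : Set (EucSp n)} (hD : IsOpen D) (hDc : IsConnected D)
    {f m : EucSp n → EucSp n} (hf : ContDiffOn ℝ ∞ f D) (hm : ContDiffOn ℝ ∞ m D)
    (hU : MapsTo f D U.dom) (hinj : ∀ x ∈ D, Function.Injective (fderiv ℝ f x))
    (h : ∀ x ∈ D, ∃ a, m x = U.act a (f x)) : ∃ a, EqOn m (U.act a ∘ f) D := by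
  have hact : ∀ a, ContDiffOn ℝ ∞ (U.act a ∘ f) D := fun a => (U.act_smooth a).comp hf hU
  have := hD.baireSpace
  have : Nonempty D := hDc.nonempty.to_subtype
  -- The relatively closed sets where `m = a ∘ f`, one for each `a`, cover `D`. By Baire's theorem
  -- one of them has interior, which supplies the point with equal 1-jets.
  obtain ⟨a, ⟨x₀, hx₀⟩, hx⟩ := nonempty_interior_of_iUnion_of_closed
    (f := fun a : U.G => {x : D | m x = U.act a (f x)})
    (fun a => isClosed_eq hm.continuousOn.domRestrict (hact a).continuousOn.domRestrict)
    (eq_univ_of_forall fun x => mem_iUnion.2 (h x x.2))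
  have hev : m =ᶠ[𝓝 x₀] U.act a ∘ f := by
    have h1 := mem_interior_iff_mem_nhds.1 hx
    rw [mem_nhds_subtype_iff_nhdsWithin, nhdsWithin_eq_nhds.2 (hD.mem_nhds hx₀)] at h1
    filter_upwards [h1]
    rintro _ ⟨z, hz, rfl⟩
    exact hz
  refine ⟨a, U.eqOn_of_jet_eq hD hDc.isPreconnected (hact a) hm
    (fun x hx => U.act_mapsTo a (hU hx)) (fun x hx => ?_) (fun x hx => ?_) hx₀
    hev.self_of_nhds hev.fderiv_eq⟩
  · rw [fderiv_comp x (U.differentiableAt_act a (hU hx))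
      ((hf.contDiffAt (hD.mem_nhds hx)).differentiableAt (by simp))]
    exact (U.injective_fderiv_act a (hU hx)).comp (hinj x hx)
  · obtain ⟨b, hb⟩ := h x hx
    refine ⟨b * a⁻¹, ?_⟩
    rw [hb, Function.comp_apply, ← U.act_mul _ _ _ (hU hx), inv_mul_cancel_right]

end LocalModel

/-! ### Regular level sets -/

/-- Near a regular point, a level set is parametrized by a smooth map defined on an open subset of
Euclidean space whose inverse is the restriction of a linear map. -/
theorem exists_chart_of_regular_level {A B : Type*} [NormedAddCommGroup A] [NormedSpace ℝ A]
    [FiniteDimensional ℝ A] [NormedAddCommGroup B] [NormedSpace ℝ B] [FiniteDimensional ℝ B]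
    {d : ℕ} {Φ : A → B} {Ω : Set A} (hΩ : IsOpen Ω) (hΦ : ContDiffOn ℝ ∞ Φ Ω) {b : B} {S : Set A}
    (hS : ∀ a, a ∈ S ↔ a ∈ Ω ∧ Φ a = b) (p : S)
    (hsurj : Function.Surjective (fderiv ℝ Φ (p : A)))
    (hd : Module.finrank ℝ A = Module.finrank ℝ B + d) :
    ∃ κ : OpenPartialHomeomorph S (EucSp d), p ∈ κ.source ∧
      ContDiffOn ℝ ∞ (fun y => (κ.symm y : A)) κ.target ∧
      ∃ π : A →L[ℝ] EucSp d, ∀ q : S, κ q = π q := by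
  have : CompleteSpace A := FiniteDimensional.complete ℝ A
  set T : A →ₗ[ℝ] B := (fderiv ℝ Φ (p : A) : A →ₗ[ℝ] B) with hT
  have hK : Module.finrank ℝ T.ker = Module.finrank ℝ (EucSp d) := by
    have h1 := T.finrank_range_add_finrank_ker
    rw [LinearMap.range_eq_top.2 hsurj, finrank_top] at h1
    rw [finrank_euclideanSpace_fin]
    omega
  obtain ⟨P, hP⟩ := T.ker.subtype.exists_leftInverse_of_injective T.ker.ker_subtype
  -- A linear projection onto the kernel of the derivative, identified with Euclidean space,
  -- completes `Φ` to a map `Ψ` with invertible derivative at `p`.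
  let π : A →L[ℝ] EucSp d :=
    LinearMap.toContinuousLinearMap ((LinearEquiv.ofFinrankEq _ _ hK).toLinearMap ∘ₗ P)
  have hπ : ∀ v, T v = 0 → π v = 0 → v = 0 := by
    intro v hv hv'
    have h1 : P v = 0 := (LinearEquiv.map_eq_zero_iff (LinearEquiv.ofFinrankEq _ _ hK)).1 hv'
    have h2 : P v = ⟨v, hv⟩ := LinearMap.congr_fun hP ⟨v, hv⟩
    rw [h2] at h1
    exact congrArg Subtype.val h1
  let Ψ : A → B × EucSp d := fun a => (Φ a, π a)
  have hΨ : ContDiffOn ℝ ∞ Ψ Ω := hΦ.prodMk π.contDiff.contDiffOn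
  have hpΩ : (p : A) ∈ Ω := ((hS p).1 p.2).1
  have hΨat : ∀ a ∈ Ω, ContDiffAt ℝ ∞ Ψ a := fun a ha => hΨ.contDiffAt (hΩ.mem_nhds ha)
  have hΨ' : fderiv ℝ Ψ (p : A) = (fderiv ℝ Φ (p : A)).prod π :=
    (((hΦ.contDiffAt (hΩ.mem_nhds hpΩ)).differentiableAt (by simp)).hasFDerivAt.prodMk
      π.hasFDerivAt).fderiv
  obtain ⟨L, hL⟩ : ∃ L : A ≃L[ℝ] B × EucSp d, (L : A →L[ℝ] B × EucSp d) = fderiv ℝ Ψ (p : A) := by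
    have hinj : Function.Injective (fderiv ℝ Ψ (p : A)).toLinearMap := by
      rw [← LinearMap.ker_eq_bot, LinearMap.ker_eq_bot']
      intro v hv
      have hv' : (fderiv ℝ Φ (p : A) v, π v) = 0 := by
        have := hΨ' ▸ hv
        exact this
      exact hπ v (congrArg Prod.fst hv') (congrArg Prod.snd hv')
    refine ⟨(LinearMap.linearEquivOfInjective _ hinj ?_).toContinuousLinearEquiv, ?_⟩
    · rw [hd, Module.finrank_prod, finrank_euclideanSpace_fin]
    · ext1 x; rfl
  have hstrict : HasStrictFDerivAt Ψ (L : A →L[ℝ] B × EucSp d) p := by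
    rw [hL]; exact (hΨat p hpΩ).hasStrictFDerivAt (by simp)
  -- Restricting to points where `DΨ` is invertible makes the local inverse smooth on its whole
  -- target, not just near the image of `p`.
  set Ω' : Set A := Ω ∩ fderiv ℝ Ψ ⁻¹' range ((↑) : (A ≃L[ℝ] B × EucSp d) → _) with hΩ'
  have hΩ'o : IsOpen Ω' :=
    (hΨ.continuousOn_fderiv_of_isOpen hΩ (by simp)).isOpen_inter_preimage hΩ
      ContinuousLinearEquiv.isOpen
  set e := (hstrict.toOpenPartialHomeomorph Ψ).restrOpen Ω' hΩ'o with he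
  have heΨ : ∀ a, e a = Ψ a := fun a => rfl
  have hes : e.source ⊆ Ω' := by
    rw [he, OpenPartialHomeomorph.restrOpen_source]
    exact inter_subset_right
  have hpe : (p : A) ∈ e.source := by
    rw [he, OpenPartialHomeomorph.restrOpen_source]
    exact ⟨hstrict.mem_toOpenPartialHomeomorph_source, hpΩ, L, hL⟩
  have hsymm : ContDiffOn ℝ ∞ e.symm e.target := by
    intro z hz
    obtain ⟨h1, M, hM⟩ := hes (e.map_target hz)
    refine (e.contDiffAt_symm (f₀' := M) hz ?_ (hΨat _ h1)).contDiffWithinAt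
    rw [hM]
    exact ((hΨat _ h1).differentiableAt (by simp)).hasFDerivAt
  have hmem : ∀ y, (b, y) ∈ e.target → e.symm (b, y) ∈ S := fun y hy =>
    (hS _).2 ⟨(hes (e.map_target hy)).1, congrArg Prod.fst (e.right_inv hy)⟩
  have hSb : ∀ q : S, Ψ q = (b, π q) := fun q => Prod.ext ((hS q).1 q.2).2 rfl
  classical
  let κ : OpenPartialHomeomorph S (EucSp d) :=
    { toFun := fun q => π q
      -- The value `p` off the target is a dummy.
      invFun := fun y => if h : (b, y) ∈ e.target then ⟨e.symm (b, y), hmem y h⟩ else p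
      source := {q | (q : A) ∈ e.source}
      target := {y | (b, y) ∈ e.target}
      map_source' := fun q hq => by
        have := e.map_source hq
        rwa [heΨ, hSb] at this
      map_target' := fun y hy => by
        have hy' : (b, y) ∈ e.target := hy
        simp only [dif_pos hy']
        exact e.map_target hy'
      left_inv' := fun q hq => by
        have h1 := e.map_source hq
        have h2 := e.left_inv hq
        rw [heΨ, hSb] at h1 h2
        simp only [dif_pos h1]
        exact Subtype.ext h2
      right_inv' := fun y hy => by
        have hy' : (b, y) ∈ e.target := hy
        simp only [dif_pos hy']
        exact congrArg Prod.snd (e.right_inv hy')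
      open_source := e.open_source.preimage continuous_subtype_val
      open_target := e.open_target.preimage (by fun_prop)
      continuousOn_toFun := by fun_prop
      continuousOn_invFun := by
        rw [IsInducing.subtypeVal.continuousOn_iff]
        refine ContinuousOn.congr (f := fun y => e.symm (b, y))
          (e.continuousOn_symm.comp (by fun_prop) fun y hy => hy) fun y hy => ?_
        have hy' : (b, y) ∈ e.target := hy
        simp only [Function.comp_apply, dif_pos hy'] }
  refine ⟨κ, hpe, ?_, π, fun q => rfl⟩
  refine ContDiffOn.congr (f := fun y => e.symm (b, y))
    (hsymm.comp (by fun_prop) fun y hy => hy) fun y hy => ?_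
  have hy' : (b, y) ∈ e.target := hy
  change ((if h : (b, y) ∈ e.target then (⟨e.symm (b, y), hmem y h⟩ : S) else p : S) : A) = _
  rw [dif_pos hy']

/-! ### Action of maps on frames -/

/-- Pairs of a point of Euclidean `n`-space and an `n`-tuple of vectors. -/
abbrev FrameSp (n : ℕ) : Type := EucSp n × (Fin n → EucSp n)

/-- The map induced by `σ` on frames. -/
def frameMap {n : ℕ} (σ : EucSp n → EucSp n) (p : FrameSp n) : FrameSp n :=
  (σ p.1, fun i => fderiv ℝ σ p.1 (p.2 i))

section frameMap

variable {n : ℕ} {σ τ : EucSp n → EucSp n} {p : FrameSp n}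

theorem frameMap_comp (hτ : DifferentiableAt ℝ τ (σ p.1)) (hσ : DifferentiableAt ℝ σ p.1) :
    frameMap (τ ∘ σ) p = frameMap τ (frameMap σ p) := by
  simp only [frameMap, fderiv_comp p.1 hτ hσ]
  rfl

theorem frameMap_congr (h : σ =ᶠ[𝓝 p.1] τ) : frameMap σ p = frameMap τ p := by
  simp only [frameMap, h.fderiv_eq, h.self_of_nhds]

theorem frameMap_id : frameMap id p = p := by
  simp [frameMap]

theorem contDiffOn_frameMap {D : Set (EucSp n)} (hD : IsOpen D) (hσ : ContDiffOn ℝ ∞ σ D) :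
    ContDiffOn ℝ ∞ (frameMap σ) {p | p.1 ∈ D} := by
  have hmap : MapsTo Prod.fst {p : FrameSp n | p.1 ∈ D} D := fun p hp => hp
  refine (hσ.comp contDiff_fst.contDiffOn hmap).prodMk ?_
  refine contDiffOn_pi.2 fun i => ?_
  have h1 : ContDiffOn ℝ ∞ (fderiv ℝ σ) D := hσ.fderiv_of_isOpen hD (by simp)
  exact (h1.comp contDiff_fst.contDiffOn hmap).clm_apply (by fun_prop)

end frameMap

theorem injective_orbitSpaceMap_iff {G D X : Type*} [Group G] [MulAction G D] {f : D → X}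
    (hf : ∀ (a : G) (p : D), f (a • p) = f p) :
    Function.Injective (orbitSpaceMap G f hf) ↔ ∀ p q, f p = f q → ∃ a : G, a • p = q := by
  constructor
  · intro h p q hpq
    have h1 : (Quotient.mk _ q : MulAction.orbitRel.Quotient G D) = Quotient.mk _ p := h hpq.symm
    exact MulAction.orbitRel_apply.1 (Quotient.exact h1)
  · rintro h ⟨p⟩ ⟨q⟩ hpq
    obtain ⟨a, ha⟩ := h q p hpq.symm
    exact Quotient.sound (MulAction.orbitRel_apply.2 ⟨a, ha⟩)

/-! ### Chart embeddings as diffeomorphisms onto open sets -/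

namespace OrbifoldChart

variable {n : ℕ} {X : Type u} [TopologicalSpace X] {U V : OrbifoldChart n X}

theorem exists_smul_eq_of_proj_eq {x y : U.dom} (h : U.proj x = U.proj y) :
    ∃ a : U.G, a • x = y :=
  (injective_orbitSpaceMap_iff U.proj_smul).1 U.isOpenEmbedding_orbitSpaceMap.injective x y h

/-- An embedding of charts is a diffeomorphism onto an open subset. -/
theorem IsEmb.exists_openPartialHomeomorph {f : EucSp n → EucSp n} (hf : U.IsEmb V f) :
    ∃ σ : OpenPartialHomeomorph (EucSp n) (EucSp n), σ.source = U.dom ∧ (σ : _ → _) = f ∧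
      ContDiffOn ℝ ∞ σ.symm σ.target := by
  have hinj : InjOn f U.dom := fun x hx y hy hxy =>
    congrArg Subtype.val (hf.isEmbedding.injective (a₁ := ⟨x, hx⟩) (a₂ := ⟨y, hy⟩) hxy)
  have hat : ∀ x ∈ U.dom, ContDiffAt ℝ ∞ f x := fun x hx =>
    hf.smooth.contDiffAt (U.model.isOpen_dom.mem_nhds hx)
  have hopen : IsOpenMap (U.dom.domRestrict f) := by
    refine IsOpenMap.of_nhds_le fun x => ?_
    obtain ⟨L, hL⟩ := exists_continuousLinearEquiv_of_injective (hf.immersion x x.2)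
    have hs : HasStrictFDerivAt f (L : EucSp n →L[ℝ] EucSp n) x := by
      rw [hL]; exact (hat x x.2).hasStrictFDerivAt (by simp)
    -- Openness is checked at each point by the inverse function theorem; as the domain is open, its
    -- neighbourhoods are those of the ambient space.
    have h1 : Filter.map ((↑) : U.dom → EucSp n) (𝓝 x) = 𝓝 (x : EucSp n) :=
      U.model.isOpen_dom.isOpenEmbedding_subtypeVal.map_nhds_eq x
    change 𝓝 (f x) ≤ Filter.map (f ∘ (↑)) (𝓝 x)
    rw [← Filter.map_map, h1, hs.map_nhds_eq_of_equiv]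
  let e : PartialEquiv (EucSp n) (EucSp n) := hinj.toPartialEquiv f U.dom
  let σ := OpenPartialHomeomorph.ofContinuousOpenRestrict e hf.smooth.continuousOn hopen
    U.model.isOpen_dom
  refine ⟨σ, rfl, rfl, fun z hz => ?_⟩
  have hz' : σ.symm z ∈ U.dom := σ.map_target hz
  obtain ⟨L, hL⟩ := exists_continuousLinearEquiv_of_injective (hf.immersion _ hz')
  refine (σ.contDiffAt_symm (f₀' := L) hz ?_ (hat _ hz')).contDiffWithinAt
  rw [hL]
  exact ((hat _ hz').differentiableAt (by simp)).hasFDerivAt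

end OrbifoldChart

namespace OrbifoldMetric

variable {n : ℕ} {X : Type u} [TopologicalSpace X] {𝒰 : OrbifoldAtlas n X}

/-! ### Local lifts of the identity -/

/-- A diffeomorphism `σ` between open subsets of the domains of two charts is a lift of the identity
if it commutes with the chart maps, is isometric, and identifies each frame with its image in the
frame bundle. -/
structure IsLift (g : OrbifoldMetric 𝒰) (U V : 𝒰.charts)
    (σ : OpenPartialHomeomorph (EucSp n) (EucSp n)) : Prop where
  source_subset : σ.source ⊆ U.1.dom
  target_subset : σ.target ⊆ V.1.dom
  contDiffOn : ContDiffOn ℝ ∞ σ σ.source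
  contDiffOn_symm : ContDiffOn ℝ ∞ σ.symm σ.target
  proj_eq : ∀ x (hx : x ∈ σ.source), V.1.proj ⟨σ x, target_subset (σ.map_source hx)⟩ =
    U.1.proj ⟨x, source_subset hx⟩
  isometry : ∀ x ∈ σ.source, ∀ v w,
    g.form V (σ x) (fderiv ℝ σ x v) (fderiv ℝ σ x w) = g.form U x v w
  frameProj_eq : ∀ (p : g.frames U) (q : g.frames V), p.1.1 ∈ σ.source → q.1 = frameMap σ p →
    g.frameProj V q = g.frameProj U p

namespace IsLift

variable {g : OrbifoldMetric 𝒰} {U V W : 𝒰.charts}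
  {σ τ : OpenPartialHomeomorph (EucSp n) (EucSp n)}

theorem differentiableAt (h : g.IsLift U V σ) {x : EucSp n} (hx : x ∈ σ.source) :
    DifferentiableAt ℝ σ x :=
  (h.contDiffOn.contDiffAt (σ.open_source.mem_nhds hx)).differentiableAt (by simp)

theorem differentiableAt_symm (h : g.IsLift U V σ) {x : EucSp n} (hx : x ∈ σ.target) :
    DifferentiableAt ℝ σ.symm x :=
  (h.contDiffOn_symm.contDiffAt (σ.open_target.mem_nhds hx)).differentiableAt (by simp)

theorem frameMap_mem (h : g.IsLift U V σ) {p : FrameSp n} (hp : p ∈ g.frames U)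
    (hps : p.1 ∈ σ.source) : frameMap σ p ∈ g.frames V :=
  ⟨h.target_subset (σ.map_source hps), fun i j =>
    (h.isometry _ hps (p.2 i) (p.2 j)).trans (hp.2 i j)⟩

theorem frameMap_frameMap_symm (h : g.IsLift U V σ) {p : FrameSp n} (hp : p.1 ∈ σ.target) :
    frameMap σ (frameMap σ.symm p) = p := by
  rw [← frameMap_comp (h.differentiableAt (σ.map_target hp)) (h.differentiableAt_symm hp)]
  have : σ ∘ σ.symm =ᶠ[𝓝 p.1] id := by
    filter_upwards [σ.open_target.mem_nhds hp] with z hz using σ.right_inv hz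
  rw [frameMap_congr this, frameMap_id]

theorem symm (h : g.IsLift U V σ) : g.IsLift V U σ.symm where
  source_subset := h.target_subset
  target_subset := h.source_subset
  contDiffOn := h.contDiffOn_symm
  contDiffOn_symm := h.contDiffOn
  proj_eq x hx := by
    have := h.proj_eq (σ.symm x) (σ.map_target hx)
    rw [← this]
    congr 2
    exact σ.right_inv hx
  isometry x hx v w := by
    have hx' : x ∈ σ.target := hx
    have hy := σ.map_target hx'
    have h1 : (fderiv ℝ σ (σ.symm x)).comp (fderiv ℝ σ.symm x) =
        ContinuousLinearMap.id ℝ (EucSp n) := by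
      rw [← fderiv_comp x (h.differentiableAt hy) (h.differentiableAt_symm hx)]
      have : σ ∘ σ.symm =ᶠ[𝓝 x] id := by
        filter_upwards [σ.open_target.mem_nhds hx'] with z hz using σ.right_inv hz
      rw [this.fderiv_eq, fderiv_id]
    have h2 : ∀ v, fderiv ℝ σ (σ.symm x) (fderiv ℝ σ.symm x v) = v := fun v =>
      DFunLike.congr_fun h1 v
    rw [← h.isometry _ hy, h2, h2, σ.right_inv hx']
  frameProj_eq p q hp hq := by
    refine (h.frameProj_eq q p ?_ ?_).symm
    · rw [hq]; exact σ.map_target hp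
    · rw [hq, h.frameMap_frameMap_symm hp]

theorem trans (h : g.IsLift U V σ) (h' : g.IsLift V W τ) : g.IsLift U W (σ.trans τ) := by
  have hsrc : ∀ x, x ∈ (σ.trans τ).source → x ∈ σ.source ∧ σ x ∈ τ.source := fun x hx => by
    rw [OpenPartialHomeomorph.trans_source] at hx
    exact hx
  have htgt : ∀ x, x ∈ (σ.trans τ).target → x ∈ τ.target ∧ τ.symm x ∈ σ.target := fun x hx => by
    rw [OpenPartialHomeomorph.trans_target] at hx
    exact hx
  refine
    { source_subset := fun x hx => h.source_subset (hsrc x hx).1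
      target_subset := fun x hx => h'.target_subset (htgt x hx).1
      contDiffOn := h'.contDiffOn.comp (h.contDiffOn.mono fun x hx => (hsrc x hx).1)
        fun x hx => (hsrc x hx).2
      contDiffOn_symm := h.contDiffOn_symm.comp
        (h'.contDiffOn_symm.mono fun x hx => (htgt x hx).1) fun x hx => (htgt x hx).2
      proj_eq := fun x hx => (h'.proj_eq _ (hsrc x hx).2).trans (h.proj_eq _ (hsrc x hx).1)
      isometry := fun x hx v w => ?_
      frameProj_eq := fun p q hp hq => ?_ }
  · rw [OpenPartialHomeomorph.coe_trans,
      fderiv_comp x (h'.differentiableAt (hsrc x hx).2) (h.differentiableAt (hsrc x hx).1)]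
    exact (h'.isometry _ (hsrc x hx).2 _ _).trans (h.isometry _ (hsrc x hx).1 _ _)
  · rw [OpenPartialHomeomorph.coe_trans, frameMap_comp (h'.differentiableAt (hsrc _ hp).2)
      (h.differentiableAt (hsrc _ hp).1)] at hq
    exact (h'.frameProj_eq ⟨_, h.frameMap_mem p.2 (hsrc _ hp).1⟩ q (hsrc _ hp).2 hq).trans
      (h.frameProj_eq p ⟨_, h.frameMap_mem p.2 (hsrc _ hp).1⟩ (hsrc _ hp).1 rfl)

end IsLift

variable (g : OrbifoldMetric 𝒰) {U V : 𝒰.charts}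

theorem exists_isLift_of_isEmb {f : EucSp n → EucSp n} (hf : U.1.IsEmb V.1 f) :
    ∃ σ, g.IsLift U V σ ∧ σ.source = U.1.dom ∧ (σ : _ → _) = f := by
  obtain ⟨σ, hs, rfl, hsymm⟩ := hf.exists_openPartialHomeomorph
  exact ⟨σ,
    { source_subset := hs.le
      target_subset := fun y hy => by
        rw [← σ.right_inv hy]
        exact hf.mapsTo (hs ▸ σ.map_target hy)
      contDiffOn := hs ▸ hf.smooth
      contDiffOn_symm := hsymm
      proj_eq := fun x hx => hf.proj_comp ⟨x, hs ▸ hx⟩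
      isometry := fun x hx => g.compatible U V σ hf x (hs ▸ hx)
      frameProj_eq := fun p q _ hq => (Quot.sound ⟨σ, hf, congrArg Prod.fst hq,
        congrFun (congrArg Prod.snd hq)⟩ : g.frameProj U p = g.frameProj V q).symm }, hs, rfl⟩

/-- Points of two charts with the same image in the orbifold are related by a lift of the
identity. -/
theorem exists_isLift_of_proj_eq {x : U.1.dom} {y : V.1.dom} (h : U.1.proj x = V.1.proj y) :
    ∃ σ, g.IsLift U V σ ∧ (x : EucSp n) ∈ σ.source ∧ σ x = y := by
  obtain ⟨W, hW, ⟨w, hw⟩, -, ⟨f, hf⟩, ⟨f', hf'⟩⟩ :=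
    𝒰.compatible U.1 U.2 V.1 V.2 _ ⟨mem_range_self x, y, h.symm⟩
  have key : ∀ (Z : 𝒰.charts) (z : Z.1.dom) (k : EucSp n → EucSp n), W.IsEmb Z.1 k →
      W.proj w = Z.1.proj z →
      ∃ σ, g.IsLift ⟨W, hW⟩ Z σ ∧ (w : EucSp n) ∈ σ.source ∧ σ w = z := by
    intro Z z k hk hwz
    -- The embedding need only send `w` into the orbit of `z`. Composing with a group element,
    -- itself an embedding, makes it hit `z`.
    obtain ⟨a, ha⟩ := OrbifoldChart.exists_smul_eq_of_proj_eq ((hk.proj_comp w).trans hwz)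
    obtain ⟨σ, h1, h2, rfl⟩ := g.exists_isLift_of_isEmb (U := ⟨W, hW⟩) (V := Z) hk
    obtain ⟨τ, h3, h4, h5⟩ := g.exists_isLift_of_isEmb (U := Z) (V := Z) (Z.1.isEmb_act a)
    refine ⟨σ.trans τ, h1.trans h3, ?_, ?_⟩
    · rw [OpenPartialHomeomorph.trans_source]
      refine ⟨h2 ▸ w.2, ?_⟩
      rw [mem_preimage, h4]
      exact hk.mapsTo w.2
    · rw [OpenPartialHomeomorph.coe_trans, h5]
      exact congrArg Subtype.val ha
  obtain ⟨σ, h1, h2, h3⟩ := key U x f hf hw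
  obtain ⟨τ, h4, h5, h6⟩ := key V y f' hf' (hw.trans h)
  refine ⟨σ.symm.trans τ, h1.symm.trans h4, ?_, ?_⟩
  · rw [OpenPartialHomeomorph.trans_source, ← h3]
    refine ⟨σ.map_source h2, ?_⟩
    rw [mem_preimage, σ.left_inv h2]
    exact h5
  · rw [OpenPartialHomeomorph.coe_trans, Function.comp_apply, ← h3, σ.left_inv h2, h6]

/-- Two frames have the same image in the frame bundle if and only if they are related by a lift of
the identity. -/
theorem frameProj_eq_frameProj_iff {p : g.frames U} {q : g.frames V} :
    g.frameProj U p = g.frameProj V q ↔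
      ∃ σ, g.IsLift U V σ ∧ p.1.1 ∈ σ.source ∧ q.1 = frameMap σ p := by
  refine ⟨fun h => ?_, fun ⟨σ, h1, h2, h3⟩ => (h1.frameProj_eq p q h2 h3).symm⟩
  -- Generalizing to points of the disjoint union permits induction on the generated equivalence
  -- relation; lifts are closed under the operations that occur.
  suffices H : ∀ P Q : (Σ U : 𝒰.charts, g.frames U), Relation.EqvGen g.Glue P Q →
      ∃ σ, g.IsLift P.1 Q.1 σ ∧ P.2.1.1 ∈ σ.source ∧ Q.2.1 = frameMap σ P.2.1 from
    H ⟨U, p⟩ ⟨V, q⟩ (Quot.eqvGen_exact h)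
  intro P Q hPQ
  induction hPQ with
  | rel P Q h =>
    obtain ⟨f, hf, h1, h2⟩ := h
    obtain ⟨σ, h3, h4, rfl⟩ := g.exists_isLift_of_isEmb hf
    exact ⟨σ, h3, h4 ▸ P.2.2.1, Prod.ext h1 (funext h2)⟩
  | refl P =>
    obtain ⟨σ, h3, h4, h5⟩ := g.exists_isLift_of_isEmb (P.1.1.isEmb_act 1)
    refine ⟨σ, h3, h4 ▸ P.2.2.1, ?_⟩
    rw [h5]
    exact congrArg Subtype.val (one_smul P.1.1.G P.2).symm
  | symm P Q _ ih =>
    obtain ⟨σ, h1, h2, h3⟩ := ih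
    have h4 : Q.2.1.1 ∈ σ.target := by rw [h3]; exact σ.map_source h2
    refine ⟨σ.symm, h1.symm, h4, ?_⟩
    rw [h3]
    exact (h1.symm.frameMap_frameMap_symm h2).symm
  | trans P Q R _ _ ih1 ih2 =>
    obtain ⟨σ, h1, h2, h3⟩ := ih1
    obtain ⟨τ, h4, h5, h6⟩ := ih2
    have h7 : σ P.2.1.1 ∈ τ.source := by rw [h3] at h5; exact h5
    refine ⟨σ.trans τ, h1.trans h4, ?_, ?_⟩
    · rw [OpenPartialHomeomorph.trans_source]
      exact ⟨h2, h7⟩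
    · rw [OpenPartialHomeomorph.coe_trans,
        frameMap_comp (h4.differentiableAt h7) (h1.differentiableAt h2), h6, h3]

/-- A lift of the identity from a chart to itself is locally given by a group element. -/
theorem IsLift.exists_frameMap_eq_smul {g : OrbifoldMetric 𝒰}
    {σ : OpenPartialHomeomorph (EucSp n) (EucSp n)} (h : g.IsLift U U σ) (p : g.frames U)
    (hp : p.1.1 ∈ σ.source) : ∃ a : U.1.G, frameMap σ p = (a • p : g.frames U) := by
  obtain ⟨r, hr, hball⟩ := Metric.isOpen_iff.1 σ.open_source _ hp
  -- Commuting with the chart map places `σ x` in the orbit of `x`, with an element that may depend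
  -- on `x`. Rigidity on a ball makes it constant, so derivatives may be compared.
  obtain ⟨a, ha⟩ := U.1.model.exists_eqOn_act (f := id) Metric.isOpen_ball
    (Metric.isConnected_ball hr) contDiff_id.contDiffOn (h.contDiffOn.mono hball)
    (fun x hx => h.source_subset (hball hx))
    (fun x _ => by rw [fderiv_id]; exact Function.injective_id)
    (fun x hx => by
      obtain ⟨a, ha⟩ := OrbifoldChart.exists_smul_eq_of_proj_eq (h.proj_eq x (hball hx)).symm
      exact ⟨a, (congrArg Subtype.val ha).symm⟩)
  exact ⟨a, frameMap_congr (ha.eventuallyEq_of_mem (Metric.ball_mem_nhds _ hr))⟩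

theorem exists_smul_eq_of_frameProj_eq {p q : g.frames U}
    (h : g.frameProj U p = g.frameProj U q) : ∃ a : U.1.G, a • p = q := by
  obtain ⟨σ, h1, h2, h3⟩ := g.frameProj_eq_frameProj_iff.1 h
  obtain ⟨a, ha⟩ := h1.exists_frameMap_eq_smul p h2
  exact ⟨a, Subtype.ext (ha.symm.trans h3.symm)⟩

/-- A point of the frame bundle over a point of a chart is represented by a frame at that point. -/
theorem exists_frameProj_eq_of_proj_eq (r : g.frames V) (y : U.1.dom)
    (h : V.1.proj ⟨r.1.1, r.2.1⟩ = U.1.proj y) :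
    ∃ p : g.frames U, p.1.1 = y ∧ g.frameProj U p = g.frameProj V r := by
  obtain ⟨σ, h1, h2, h3⟩ := g.exists_isLift_of_proj_eq h
  exact ⟨⟨frameMap σ r, h1.frameMap_mem r.2 h2⟩, h3, h1.frameProj_eq _ _ h2 rfl⟩

end OrbifoldMetric

/-! ### Topology of the frame bundle -/

/-- A space with a continuous map to a paracompact space is paracompact if every point of the target
has a neighborhood whose preimage is contained in a compact set. -/
theorem paracompactSpace_of_preimage_subset_isCompact {X Y : Type*} [TopologicalSpace X]
    [ParacompactSpace X] [TopologicalSpace Y] {f : Y → X} (hf : Continuous f)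
    (h : ∀ x, ∃ N, IsOpen N ∧ x ∈ N ∧ ∃ K, IsCompact K ∧ f ⁻¹' N ⊆ K) : ParacompactSpace Y := by
  choose N hNo hxN K hK hNK using h
  refine ⟨fun α s hs hsu => ?_⟩
  have hfin : ∀ x, ∃ t : Finset α, K x ⊆ ⋃ a ∈ t, s a := fun x =>
    (hK x).elim_finite_subcover s hs (hsu ▸ subset_univ _)
  choose t ht using hfin
  obtain ⟨M, hMo, hMu, hMf, hMN⟩ := precise_refinement N hNo
    (eq_univ_of_forall fun x => mem_iUnion.2 ⟨x, hxN x⟩)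
  -- Finitely many members of the given cover suffice over each `M x`, since its preimage lies in a
  -- compact set. Local finiteness is inherited from `M` because each `t x` is finite.
  let r : (Σ x : X, t x) → Set Y := fun i => f ⁻¹' M i.1 ∩ s i.2
  have hr : LocallyFinite r := by
    intro y
    obtain ⟨O, hO, hOf⟩ := hMf (f y)
    refine ⟨f ⁻¹' O, hf.continuousAt hO, ?_⟩
    refine (hOf.preimage' (f := (Sigma.fst : (Σ x : X, t x) → X)) fun x _ => ?_).subset ?_
    · refine (finite_range fun a : t x => (⟨x, a⟩ : Σ x : X, t x)).subset ?_
      rintro ⟨x', a⟩ rfl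
      exact mem_range_self a
    · rintro i ⟨z, ⟨hz1, -⟩, hz2⟩
      exact ⟨f z, hz1, hz2⟩
  refine ⟨range r, (↑), ?_, ?_, hr.on_range, ?_⟩
  · rintro ⟨_, i, rfl⟩
    exact ((hMo _).preimage hf).inter (hs _)
  · refine eq_univ_of_forall fun y => ?_
    obtain ⟨x, hx⟩ := mem_iUnion.1 (hMu.symm ▸ mem_univ (f y))
    obtain ⟨a, ha, hya⟩ := mem_iUnion₂.1 (ht x (hNK x (hMN x hx)))
    exact mem_iUnion.2 ⟨⟨_, ⟨x, a, ha⟩, rfl⟩, hx, hya⟩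
  · rintro ⟨_, i, rfl⟩
    exact ⟨i.2, inter_subset_right⟩

/-- A continuous open invariant map that separates orbits induces an open embedding of the orbit
space. -/
theorem isOpenEmbedding_orbitSpaceMap {G D X : Type*} [Group G] [MulAction G D]
    [TopologicalSpace D] [TopologicalSpace X] {f : D → X}
    (hf : ∀ (a : G) (p : D), f (a • p) = f p) (hc : Continuous f) (ho : IsOpenMap f)
    (hi : ∀ p q, f p = f q → ∃ a : G, a • p = q) : IsOpenEmbedding (orbitSpaceMap G f hf) := by
  refine IsOpenEmbedding.of_continuous_injective_isOpenMap (hc.quotient_lift _)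
    ((injective_orbitSpaceMap_iff hf).2 hi) fun O hO => ?_
  have : orbitSpaceMap G f hf '' O = f '' (Quotient.mk _ ⁻¹' O) := by
    ext x
    constructor
    · rintro ⟨⟨p⟩, hp, rfl⟩
      exact ⟨p, hp, rfl⟩
    · rintro ⟨p, hp, rfl⟩
      exact ⟨_, hp, rfl⟩
  rw [this]
  exact ho _ (hO.preimage continuous_quotient_mk')

instance LocalModel.instContinuousConstSMul {n : ℕ} (U : LocalModel n) :
    ContinuousConstSMul U.G U.dom :=
  ⟨fun a => Continuous.subtype_mk ((U.act_smooth a).continuousOn.domRestrict) _⟩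

namespace OrbifoldChart

variable {n : ℕ} {X : Type u} [TopologicalSpace X] (U : OrbifoldChart n X)

theorem continuous_proj : Continuous U.proj :=
  U.isOpenEmbedding_orbitSpaceMap.continuous.comp continuous_quotient_mk'

theorem isOpenMap_proj : IsOpenMap U.proj :=
  U.isOpenEmbedding_orbitSpaceMap.isOpenMap.comp isOpenMap_quotient_mk'_mul

end OrbifoldChart

/-- A positive definite symmetric bilinear form on Euclidean space has an orthonormal basis. -/
theorem exists_orthonormal_of_posDef {n : ℕ} (B : EucSp n →L[ℝ] EucSp n →L[ℝ] ℝ)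
    (hsymm : ∀ v w, B v w = B w v) (hpos : ∀ v, v ≠ 0 → 0 < B v v) :
    ∃ v : Fin n → EucSp n, ∀ i j, B (v i) (v j) = if i = j then 1 else 0 := by
  let B' : LinearMap.BilinForm ℝ (EucSp n) := LinearMap.mk₂ ℝ (fun v w => B v w)
    (by simp) (by simp) (by simp) (by simp)
  obtain ⟨b₀, hb₀⟩ := LinearMap.BilinForm.exists_orthogonal_basis (B := B') ⟨fun v w => hsymm v w⟩
  let b := b₀.reindex (finCongr finrank_euclideanSpace_fin)
  have hb : ∀ i j, i ≠ j → B (b i) (b j) = 0 := fun i j hij => by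
    simp only [b, Module.Basis.reindex_apply]
    exact hb₀ (by simpa using hij)
  refine ⟨fun i => (√(B (b i) (b i)))⁻¹ • b i, fun i j => ?_⟩
  have hp := hpos (b i) (b.ne_zero i)
  split_ifs with hij
  · subst hij
    have h1 := Real.mul_self_sqrt hp.le
    have h2 := (Real.sqrt_pos.2 hp).ne'
    simp only [map_smul, smul_apply, smul_eq_mul]
    field_simp
    rw [sq, h1]
  · simp [hb i j hij]

namespace OrbifoldMetric

variable {n : ℕ} {X : Type u} [TopologicalSpace X] {𝒰 : OrbifoldAtlas n X}
  (g : OrbifoldMetric 𝒰) (U : 𝒰.charts)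

instance instContinuousConstSMulFrames : ContinuousConstSMul U.1.G (g.frames U) := by
  refine ⟨fun a => Continuous.subtype_mk ?_ _⟩
  exact (contDiffOn_frameMap U.1.model.isOpen_dom
    (U.1.model.act_smooth a)).continuousOn.comp_continuous continuous_subtype_val fun p => p.2.1

theorem continuous_frameProj : Continuous (g.frameProj U) :=
  continuous_quot_mk.comp continuous_sigmaMk

/-- Openness in the quotient is tested over every chart `V`. A frame over `V` identified with one in
`O` is carried to it by a lift, which also carries nearby frames into `O`. -/
theorem isOpenMap_frameProj : IsOpenMap (g.frameProj U) := by
  rintro _ ⟨O, hO, rfl⟩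
  refine isOpen_coinduced.2 (isOpen_sigma_iff.2 fun V => isOpen_iff_mem_nhds.2 ?_)
  rintro q ⟨p, hp, hpq⟩
  obtain ⟨σ, h1, h2, h3⟩ := g.frameProj_eq_frameProj_iff.1 hpq.symm
  have hD : IsOpen {p : FrameSp n | p.1 ∈ σ.source} := σ.open_source.preimage continuous_fst
  have hc : ContinuousAt (frameMap σ) q.1 :=
    (contDiffOn_frameMap σ.open_source h1.contDiffOn).continuousOn.continuousAt (hD.mem_nhds h2)
  have hqO : frameMap σ q.1 ∈ O := h3 ▸ hp
  have hev : ∀ᶠ q' : g.frames V in 𝓝 q, q'.1.1 ∈ σ.source ∧ frameMap σ q'.1 ∈ O :=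
    continuousAt_subtype_val.eventually
      (Filter.Eventually.and (hD.mem_nhds h2) (hc.eventually (hO.mem_nhds hqO)))
  filter_upwards [hev] with q' hq'
  exact ⟨⟨frameMap σ q', h1.frameMap_mem q'.2 hq'.1⟩, hq'.2,
    (h1.frameProj_eq q' _ hq'.1 rfl)⟩

theorem isOpenEmbedding_orbitSpaceMap_frameProj :
    IsOpenEmbedding (orbitSpaceMap U.1.G (g.frameProj U) (g.frameProj_smul U)) :=
  isOpenEmbedding_orbitSpaceMap _ (g.continuous_frameProj U) (g.isOpenMap_frameProj U)
    fun _ _ => g.exists_smul_eq_of_frameProj_eq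

theorem exists_frameProj_eq (q : g.FrameBundle) : ∃ U p, g.frameProj U p = q := by
  obtain ⟨⟨U, p⟩⟩ := q
  exact ⟨U, p, rfl⟩

/-- The map from the frame bundle to the underlying space of the orbifold. -/
def baseProj : g.FrameBundle → X :=
  Quot.lift (fun p => p.1.1.proj ⟨p.2.1.1, p.2.2.1⟩) (by
    rintro ⟨U, p⟩ ⟨V, q⟩ ⟨f, hf, h1, -⟩
    rw [← hf.proj_comp]
    congr 2
    exact h1.symm)

theorem continuous_baseProj : Continuous g.baseProj := by
  refine continuous_quot_lift _ (continuous_sigma fun U => ?_)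
  have h : Continuous fun p : g.frames U => (⟨p.1.1, p.2.1⟩ : U.1.dom) :=
    (continuous_fst.comp continuous_subtype_val).subtype_mk _
  exact U.1.continuous_proj.comp h

theorem exists_frame (x : U.1.dom) : ∃ p : g.frames U, p.1.1 = x := by
  obtain ⟨v, hv⟩ := exists_orthonormal_of_posDef (g.form U x) (g.symm U x x.2) (g.pos U x x.2)
  exact ⟨⟨(x, v), x.2, hv⟩, rfl⟩

/-- Lifts transport a frame to any chart containing its base point. The atlas condition for the
frame bundle therefore reduces to that of the base. -/
theorem range_frameProj : range (g.frameProj U) = g.baseProj ⁻¹' range U.1.proj := by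
  ext q
  constructor
  · rintro ⟨p, rfl⟩
    exact ⟨_, rfl⟩
  · rintro ⟨y, hy⟩
    obtain ⟨V, r, rfl⟩ := g.exists_frameProj_eq q
    obtain ⟨p, -, hp⟩ := g.exists_frameProj_eq_of_proj_eq r y hy.symm
    exact ⟨p, hp⟩

/-! ### Freeness of the action on frames and separation of orbits -/

variable {U}

theorem span_frame_eq_top (p : g.frames U) : Submodule.span ℝ (range p.1.2) = ⊤ := by
  refine LinearIndependent.span_eq_top_of_card_eq_finrank' ?_ (by simp)
  rw [Fintype.linearIndependent_iff]
  intro c hc i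
  have h1 : g.form U p.1.1 (p.1.2 i) (∑ j, c j • p.1.2 j) = 0 := by rw [hc, map_zero]
  simpa [map_sum, p.2.2] using h1

/-- A group element that fixes a frame is trivial. -/
theorem eq_one_of_smul_eq {a : U.1.G} {p : g.frames U} (h : a • p = p) :
    fderiv ℝ (U.1.act a) p.1.1 = ContinuousLinearMap.id ℝ (EucSp n) ∧ a = 1 := by
  have h' : frameMap (U.1.act a) p = p.1 := congrArg Subtype.val h
  have h1 : fderiv ℝ (U.1.act a) p.1.1 = ContinuousLinearMap.id ℝ (EucSp n) := by
    refine ContinuousLinearMap.coe_injective (LinearMap.ext_on_range (g.span_frame_eq_top p)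
      fun i => congrFun (congrArg Prod.snd h') i)
  exact ⟨h1, U.1.model.eq_one_of_jet_eq p.2.1 (congrArg Prod.fst h') h1⟩

theorem faithfulSMul_frames : FaithfulSMul U.1.G (g.frames U) := by
  refine ⟨fun {a b} h => ?_⟩
  obtain ⟨x, hx⟩ := U.1.model.isConnected_dom.nonempty
  obtain ⟨p, -⟩ := g.exists_frame U ⟨x, hx⟩
  refine (inv_mul_eq_one.1 (g.eq_one_of_smul_eq (p := p) ?_).2).symm
  rw [mul_smul, h p, ← mul_smul, inv_mul_cancel, one_smul]

theorem frameSingularSet_eq_empty : g.frameSingularSet = ∅ := by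
  refine eq_empty_of_forall_notMem ?_
  rintro _ ⟨U, p, rfl, h⟩
  exact h ((Subgroup.eq_bot_iff_forall _).2 fun a ha => (g.eq_one_of_smul_eq ha).2)

/-- Frames `p` and `q` not related by an element of a subset `s` of the group have neighborhoods
without points related by an element of `s`. -/
theorem exists_nhds_forall_smul_ne {p q : g.frames U} (s : Set U.1.G)
    (h : ∀ a ∈ s, a • p ≠ q) : ∃ P ∈ 𝓝 p, ∃ Q ∈ 𝓝 q, ∀ x ∈ P, ∀ y ∈ Q, ∀ a ∈ s, a • x ≠ y := by
  have hev : ∀ᶠ z : g.frames U × g.frames U in 𝓝 (p, q), ∀ a ∈ s, a • z.1 ≠ z.2 := by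
    rw [Filter.eventually_all]
    intro a
    by_cases ha : a ∈ s
    · have hc : IsOpen {z : g.frames U × g.frames U | a • z.1 ≠ z.2} :=
        isOpen_ne_fun ((continuous_const_smul a).comp continuous_fst) continuous_snd
      exact (Filter.Eventually.mono (hc.mem_nhds (h a ha))) fun z hz _ => hz
    · exact Filter.Eventually.of_forall fun z h' => absurd h' ha
  obtain ⟨P, hP, Q, hQ, hPQ⟩ := mem_nhds_prod_iff.1 hev
  exact ⟨P, hP, Q, hQ, fun x hx y hy => hPQ (mk_mem_prod hx hy)⟩

/-- Points over different base points are separated in `X`. Points over the same base point have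
representatives over one chart, where distinct orbits of a finite group have neighbourhoods with no
related points. -/
theorem t2Space_frameBundle [T2Space X] : T2Space g.FrameBundle := by
  refine t2Space_iff_nhds.2 fun q₁ q₂ hne => ?_
  by_cases hb : g.baseProj q₁ = g.baseProj q₂
  · obtain ⟨U, p, rfl⟩ := g.exists_frameProj_eq q₁
    obtain ⟨V, r, rfl⟩ := g.exists_frameProj_eq q₂
    obtain ⟨p', -, hp'⟩ := g.exists_frameProj_eq_of_proj_eq r ⟨p.1.1, p.2.1⟩ hb.symm
    rw [← hp'] at hne ⊢
    obtain ⟨P, hP, Q, hQ, hPQ⟩ := g.exists_nhds_forall_smul_ne (p := p) (q := p') univ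
      (fun a _ ha => hne (by rw [← ha, g.frameProj_smul]))
    refine ⟨_, (g.isOpenMap_frameProj U).image_mem_nhds hP, _,
      (g.isOpenMap_frameProj U).image_mem_nhds hQ, disjoint_left.2 ?_⟩
    rintro _ ⟨x, hx, rfl⟩ ⟨y, hy, hxy⟩
    obtain ⟨a, ha⟩ := g.exists_smul_eq_of_frameProj_eq hxy.symm
    exact hPQ x hx y hy a (mem_univ a) ha
  · obtain ⟨O₁, O₂, h1, h2, h3, h4, h5⟩ := separated_by_continuous g.continuous_baseProj hb
    exact ⟨O₁, h1.mem_nhds h3, O₂, h2.mem_nhds h4, h5⟩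

/-! ### Compactness of frames over compact sets and paracompactness -/

variable (U) in
theorem continuousOn_form_apply_apply :
    ContinuousOn (fun p : EucSp n × EucSp n × EucSp n => g.form U p.1 p.2.1 p.2.2)
      {p | p.1 ∈ U.1.dom} := by
  have h : ContinuousOn (fun p : EucSp n × EucSp n × EucSp n => g.form U p.1)
      {p | p.1 ∈ U.1.dom} :=
    (g.smooth U).continuousOn.comp continuous_fst.continuousOn fun p hp => hp
  exact (h.clm_apply (by fun_prop)).clm_apply (by fun_prop)

variable (U) in
theorem exists_norm_le_of_form_eq_one {C : Set (EucSp n)} (hC : IsCompact C) (hCU : C ⊆ U.1.dom) :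
    ∃ R : ℝ, ∀ x ∈ C, ∀ v, g.form U x v v = 1 → ‖v‖ ≤ R := by
  have hcomp : IsCompact (C ×ˢ Metric.sphere (0 : EucSp n) 1) := hC.prod (isCompact_sphere 0 1)
  have hcont : ContinuousOn (fun p : EucSp n × EucSp n => g.form U p.1 p.2 p.2)
      (C ×ˢ Metric.sphere (0 : EucSp n) 1) :=
    (g.continuousOn_form_apply_apply U).comp
      (f := fun p : EucSp n × EucSp n => (p.1, p.2, p.2)) (by fun_prop) fun p hp => hCU hp.1
  -- `c` is a positive lower bound for the form on Euclidean unit vectors over `C`. Rescaling turns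
  -- it into the bound `‖v‖ ≤ √(c⁻¹)` for unit vectors of the form.
  obtain ⟨c, hc, hcle⟩ := hcomp.exists_forall_le' hcont (a := 0) fun p hp =>
    g.pos U p.1 (hCU hp.1) p.2 (ne_zero_of_mem_unit_sphere ⟨p.2, hp.2⟩)
  refine ⟨√(c⁻¹), fun x hx v hv => Real.le_sqrt_of_sq_le ?_⟩
  have hv0 : v ≠ 0 := by
    rintro rfl
    simp at hv
  have hn := norm_pos_iff.2 hv0
  have h1 := hcle (x, ‖v‖⁻¹ • v) ⟨hx, by simp [norm_smul, hn.ne']⟩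
  simp only [map_smul, smul_apply, smul_eq_mul, hv, mul_one] at h1
  rw [le_inv_comm₀ (by positivity) hc, sq, mul_inv]
  exact h1

variable (U) in
theorem isCompact_frames_over {C : Set (EucSp n)} (hC : IsCompact C) (hCU : C ⊆ U.1.dom) :
    IsCompact {p : g.frames U | p.1.1 ∈ C} := by
  obtain ⟨R, hR⟩ := g.exists_norm_le_of_form_eq_one U hC hCU
  rw [Subtype.isCompact_iff]
  have himg : ((↑) : g.frames U → FrameSp n) '' {p | p.1.1 ∈ C} =
      {p : FrameSp n | p.1 ∈ C ∧
        ∀ i j, g.form U p.1 (p.2 i) (p.2 j) = if i = j then 1 else 0} := by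
    ext p
    constructor
    · rintro ⟨p, hp, rfl⟩
      exact ⟨hp, p.2.2⟩
    · rintro ⟨h1, h2⟩
      exact ⟨⟨p, hCU h1, h2⟩, h1, rfl⟩
  rw [himg]
  have hK : IsCompact (C ×ˢ Metric.closedBall (0 : Fin n → EucSp n) (max R 0)) :=
    hC.prod (isCompact_closedBall _ _)
  refine hK.of_isClosed_subset ?_ fun p hp => ⟨hp.1, ?_⟩
  · have hclosed : IsClosed (C ×ˢ (univ : Set (Fin n → EucSp n))) := hC.isClosed.prod isClosed_univ
    have hcont : ∀ i j, ContinuousOn (fun p : FrameSp n => g.form U p.1 (p.2 i) (p.2 j))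
        (C ×ˢ (univ : Set (Fin n → EucSp n))) := fun i j =>
      (g.continuousOn_form_apply_apply U).comp
        (f := fun p : FrameSp n => (p.1, p.2 i, p.2 j)) (by fun_prop) fun p hp => hCU hp.1
    have hcont' : ContinuousOn (fun p : FrameSp n => fun i j => g.form U p.1 (p.2 i) (p.2 j))
        (C ×ˢ (univ : Set (Fin n → EucSp n))) :=
      continuousOn_pi.2 fun i => continuousOn_pi.2 fun j => hcont i j
    convert hcont'.preimage_isClosed_of_isClosed hclosed
      (isClosed_singleton (x := fun i j : Fin n => if i = j then (1 : ℝ) else 0)) using 1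
    ext p
    simp [funext_iff]
  · rw [mem_closedBall_zero_iff, pi_norm_le_iff_of_nonneg (le_max_right _ _)]
    exact fun i => (hR p.1 hp.1 (p.2 i) (by rw [hp.2 i i, if_pos rfl])).trans (le_max_left _ _)

theorem paracompactSpace_frameBundle [ParacompactSpace X] : ParacompactSpace g.FrameBundle := by
  refine paracompactSpace_of_preimage_subset_isCompact g.continuous_baseProj fun x => ?_
  obtain ⟨U, hU, y, rfl⟩ := 𝒰.cover x
  obtain ⟨r, hr, hball⟩ := Metric.nhds_basis_closedBall.mem_iff.1
    (U.model.isOpen_dom.mem_nhds y.2)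
  refine ⟨U.proj '' {z | (z : EucSp n) ∈ Metric.ball (y : EucSp n) r},
    U.isOpenMap_proj _ (Metric.isOpen_ball.preimage continuous_subtype_val),
    ⟨y, Metric.mem_ball_self hr, rfl⟩, _, (g.isCompact_frames_over ⟨U, hU⟩
      (isCompact_closedBall _ _) hball).image (g.continuous_frameProj ⟨U, hU⟩), ?_⟩
  rintro q ⟨z, hz, hzq⟩
  obtain ⟨V, s, rfl⟩ := g.exists_frameProj_eq q
  obtain ⟨p, hp1, hp2⟩ := g.exists_frameProj_eq_of_proj_eq (U := ⟨U, hU⟩) s z hzq.symm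
  refine ⟨p, ?_, hp2⟩
  rw [mem_ofPred_eq, hp1]
  exact Metric.ball_subset_closedBall hz

end OrbifoldMetric

/-! ### The smooth structure of the frame bundle -/

theorem card_pairs_le (n : ℕ) :
    Fintype.card {ij : Fin n × Fin n // ij.1 ≤ ij.2} = (n + 1).choose 2 := by
  rw [← Fintype.card_congr (Sym2.sortEquiv (α := Fin n)), Sym2.card, Fintype.card_fin]

/-- The count is `n + n² = n(n+1)/2 + (n + n(n-1)/2)`: the Gram conditions are indexed by pairs `i ≤
j`, and the remainder is the dimension of the frame bundle. -/
theorem finrank_frameSp (n : ℕ) : Module.finrank ℝ (FrameSp n) =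
    Module.finrank ℝ ({ij : Fin n × Fin n // ij.1 ≤ ij.2} → ℝ) + (n + n.choose 2) := by
  have h1 : Module.finrank ℝ (FrameSp n) = n + n * n := by
    simp [Module.finrank_pi_fintype]
  have h2 : n.choose 2 * 2 = n * (n - 1) := by
    rw [Nat.choose_two_right, Nat.div_two_mul_two_of_even n.even_mul_pred_self]
  have h3 : (n + 1).choose 2 = n + n.choose 2 := by
    rw [Nat.choose_succ_succ' n 1, Nat.choose_one_right]
  rw [h1, Module.finrank_fintype_fun_eq_card, card_pairs_le, h3]
  cases n with
  | zero => simp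
  | succ k =>
    rw [Nat.add_sub_cancel] at h2
    nlinarith

/-! ### Frames as a regular level set of the Gram map -/

namespace OrbifoldMetric

variable {n : ℕ} {X : Type u} [TopologicalSpace X] {𝒰 : OrbifoldAtlas n X}
  (g : OrbifoldMetric 𝒰) {U V : 𝒰.charts}

variable (U) in
/-- The entries on and above the diagonal of the Gram matrix of a tuple of vectors. -/
def gram (p : FrameSp n) (ij : {ij : Fin n × Fin n // ij.1 ≤ ij.2}) : ℝ :=
  g.form U p.1 (p.2 ij.1.1) (p.2 ij.1.2)

variable (U) in
theorem contDiffOn_gram : ContDiffOn ℝ ∞ (g.gram U) {p | p.1 ∈ U.1.dom} := by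
  refine contDiffOn_pi.2 fun ij => ?_
  have h : ContDiffOn ℝ ∞ (fun p : FrameSp n => g.form U p.1) {p | p.1 ∈ U.1.dom} :=
    (g.smooth U).comp contDiff_fst.contDiffOn fun p hp => hp
  exact (h.clm_apply (by fun_prop)).clm_apply (by fun_prop)

theorem mem_frames_iff_gram (p : FrameSp n) : p ∈ g.frames U ↔
    p ∈ {p : FrameSp n | p.1 ∈ U.1.dom} ∧
      g.gram U p = fun ij => if ij.1.1 = ij.1.2 then 1 else 0 := by
  refine and_congr_right fun hp => ⟨fun h => funext fun ij => h _ _, fun h i j => ?_⟩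
  rcases le_total i j with hij | hij
  · exact congrFun h ⟨(i, j), hij⟩
  · rw [g.symm U p.1 hp]
    exact (congrFun h ⟨(j, i), hij⟩).trans (by simp only [eq_comm])

theorem fderiv_gram_apply {p : FrameSp n} (hp : p.1 ∈ U.1.dom) (w : Fin n → EucSp n)
    (ij : {ij : Fin n × Fin n // ij.1 ≤ ij.2}) :
    fderiv ℝ (g.gram U) p (0, w) ij =
      g.form U p.1 (w ij.1.1) (p.2 ij.1.2) + g.form U p.1 (p.2 ij.1.1) (w ij.1.2) := by
  have hD : IsOpen {p : FrameSp n | p.1 ∈ U.1.dom} :=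
    U.1.model.isOpen_dom.preimage continuous_fst
  have hd : HasFDerivAt (g.gram U) (fderiv ℝ (g.gram U) p) (p + (0 : ℝ) • (0, w)) := by
    rw [zero_smul, add_zero]
    exact (((g.contDiffOn_gram U).contDiffAt (hD.mem_nhds hp)).differentiableAt
      (by simp)).hasFDerivAt
  have hline : HasDerivAt (fun t : ℝ => p + t • ((0, w) : FrameSp n)) (0, w) 0 := by
    simpa using ((hasDerivAt_id (0 : ℝ)).smul_const ((0, w) : FrameSp n)).const_add p
  have h1 := hasDerivAt_pi.1 (hd.comp_hasDerivAt (0 : ℝ) hline) ij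
  -- Only the vectors vary along this line, so each Gram entry is a quadratic polynomial in `t`; the
  -- derivative of the metric never enters.
  have h2 : HasDerivAt (fun t : ℝ => g.form U p.1 (p.2 ij.1.1) (p.2 ij.1.2) +
      t * (g.form U p.1 (w ij.1.1) (p.2 ij.1.2) + g.form U p.1 (p.2 ij.1.1) (w ij.1.2)) +
      t ^ 2 * g.form U p.1 (w ij.1.1) (w ij.1.2))
      (g.form U p.1 (w ij.1.1) (p.2 ij.1.2) + g.form U p.1 (p.2 ij.1.1) (w ij.1.2)) 0 := by
    have h3 := (((hasDerivAt_id (0 : ℝ)).mul_const (g.form U p.1 (w ij.1.1) (p.2 ij.1.2) +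
      g.form U p.1 (p.2 ij.1.1) (w ij.1.2))).const_add
        (g.form U p.1 (p.2 ij.1.1) (p.2 ij.1.2))).fun_add
      ((hasDerivAt_pow 2 (0 : ℝ)).mul_const (g.form U p.1 (w ij.1.1) (w ij.1.2)))
    simpa using h3
  refine (h1.congr_of_eventuallyEq (Filter.Eventually.of_forall fun t => ?_)).unique h2
  simp only [gram, Function.comp_apply, Prod.fst_add, Prod.smul_fst, smul_zero, add_zero,
    Prod.snd_add, Prod.smul_snd, Pi.add_apply, Pi.smul_apply, map_add, map_smul,
    add_apply, smul_apply, smul_eq_mul]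
  ring

theorem surjective_fderiv_gram (p : g.frames U) :
    Function.Surjective (fderiv ℝ (g.gram U) (p : FrameSp n)) := by
  intro c
  -- Extend `c` symmetrically and halve it: varying the frame by the matrix `s` changes entry `(i,
  -- j)` by `s i j + s j i = c ij`. Keeping only `i ≤ j` is what makes surjectivity possible, the
  -- full Gram matrix being symmetric.
  let s : Fin n → Fin n → ℝ := fun i j => c ⟨(min i j, max i j), min_le_max⟩ / 2
  refine ⟨(0, fun i => ∑ k, s i k • p.1.2 k), funext fun ij => ?_⟩
  obtain ⟨⟨i, j⟩, hij⟩ := ij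
  have hij' : i ≤ j := hij
  rw [g.fderiv_gram_apply p.2.1]
  simp only [map_sum, map_smul, sum_apply, smul_apply, p.2.2,
    smul_eq_mul, mul_ite, mul_one, mul_zero, Finset.sum_ite_eq, Finset.sum_ite_eq',
    Finset.mem_univ, if_true]
  simp only [s, min_eq_left hij', max_eq_right hij', min_eq_right hij', max_eq_left hij']
  ring

theorem exists_chart_frames (p : g.frames U) :
    ∃ κ : OpenPartialHomeomorph (g.frames U) (EucSp (n + n.choose 2)), p ∈ κ.source ∧
      ContDiffOn ℝ ∞ (fun y => (κ.symm y : FrameSp n)) κ.target ∧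
      ∃ π : FrameSp n →L[ℝ] EucSp (n + n.choose 2), ∀ q : g.frames U, κ q = π q :=
  exists_chart_of_regular_level (U.1.model.isOpen_dom.preimage continuous_fst)
    (g.contDiffOn_gram U) g.mem_frames_iff_gram p (g.surjective_fderiv_gram p) (finrank_frameSp n)

/-! ### Charts of the frame bundle and their transition maps -/

/-- The chart map of the frame bundle is a local homeomorphism. -/
theorem exists_local_homeomorph_frameProj (p : g.frames U) :
    ∃ e : OpenPartialHomeomorph (g.frames U) g.FrameBundle, p ∈ e.source ∧
      (e : _ → _) = g.frameProj U := by
  -- Freeness and finiteness give a neighbourhood of `p` disjoint from its translates by nontrivial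
  -- elements, on which the projection is injective.
  obtain ⟨P, hP, Q, hQ, hPQ⟩ := g.exists_nhds_forall_smul_ne (p := p) (q := p) {a | a ≠ 1}
    fun a ha h => ha (g.eq_one_of_smul_eq h).2
  obtain ⟨O, hO, hOo, hpO⟩ := mem_nhds_iff.1 (Filter.inter_mem hP hQ)
  have hinj : InjOn (g.frameProj U) O := by
    intro x hx y hy hxy
    obtain ⟨a, ha⟩ := g.exists_smul_eq_of_frameProj_eq hxy
    by_cases h1 : a = 1
    · rw [← ha, h1, one_smul]
    · exact absurd ha (hPQ x (hO hx).1 y (hO hy).2 a h1)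
  have : Nonempty (g.frames U) := ⟨p⟩
  exact ⟨OpenPartialHomeomorph.ofContinuousOpen (hinj.toPartialEquiv _ _)
    (g.continuous_frameProj U).continuousOn (g.isOpenMap_frameProj U) hOo, hpO, rfl⟩

variable (U) in
/-- A chart `c` of the frame bundle whose inverse lifts to a smooth map `s` into the space of frames
over the chart `U`, with a linear left inverse `π`. -/
structure IsFrameChart (s : EucSp (n + n.choose 2) → FrameSp n)
    (π : FrameSp n →L[ℝ] EucSp (n + n.choose 2))
    (c : OpenPartialHomeomorph g.FrameBundle (EucSp (n + n.choose 2))) : Prop where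
  contDiffOn : ContDiffOn ℝ ∞ s c.target
  mem_frames : ∀ y ∈ c.target, s y ∈ g.frames U
  frameProj_eq : ∀ y (hy : y ∈ c.target), g.frameProj U ⟨s y, mem_frames y hy⟩ = c.symm y
  left_inv : ∀ y ∈ c.target, π (s y) = y

theorem exists_isFrameChart (p : g.frames U) :
    ∃ e : OpenPartialHomeomorph (g.frames U) g.FrameBundle, p ∈ e.source ∧
      (e : _ → _) = g.frameProj U ∧ ∃ s π c, g.IsFrameChart U s π c ∧ c.source = e.target ∧
        ∀ q ∈ e.target, s (c q) = e.symm q := by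
  obtain ⟨e₀, hp₀, he₀⟩ := g.exists_local_homeomorph_frameProj p
  obtain ⟨κ, hpκ, hκ, π, hπ⟩ := g.exists_chart_frames p
  set e := e₀.restrOpen κ.source κ.open_source with he
  have hsrc : e.source = e₀.source ∩ κ.source := e₀.restrOpen_source _ κ.open_source
  have hcoe : ∀ q, e q = g.frameProj U q := fun q => congrFun he₀ q
  have hκe : ∀ q ∈ e.target, e.symm q ∈ κ.source := fun q hq =>
    (hsrc ▸ e.map_target hq : e.symm q ∈ e₀.source ∩ κ.source).2
  set c := e.symm.trans κ with hc
  have hcs : c.source = e.target := by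
    rw [hc, OpenPartialHomeomorph.trans_source]
    exact inter_eq_left.2 hκe
  have hct : c.target ⊆ κ.target := by
    rw [hc, OpenPartialHomeomorph.trans_target]
    exact inter_subset_left
  refine ⟨e, hsrc ▸ ⟨hp₀, hpκ⟩, funext hcoe, fun y => κ.symm y, π, c,
    { contDiffOn := hκ.mono hct
      mem_frames := fun y _ => (κ.symm y).2
      frameProj_eq := fun y _ => (hcoe _).symm
      left_inv := fun y hy => by rw [← hπ, κ.right_inv (hct hy)] }, hcs, fun q hq => ?_⟩
  exact congrArg Subtype.val (κ.left_inv (hκe q hq))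

/-- Near `y₀` the transition map is `π' ∘ frameMap σ ∘ s` for a lift `σ`, which is visibly smooth.
-/
theorem IsFrameChart.contDiffOn_transition {g : OrbifoldMetric 𝒰}
    {s s' : EucSp (n + n.choose 2) → FrameSp n}
    {π π' : FrameSp n →L[ℝ] EucSp (n + n.choose 2)}
    {c c' : OpenPartialHomeomorph g.FrameBundle (EucSp (n + n.choose 2))}
    (h : g.IsFrameChart U s π c) (h' : g.IsFrameChart V s' π' c') :
    ContDiffOn ℝ ∞ (c.symm.trans c') (c.symm.trans c').source := by
  intro y₀ hy₀
  have hsrc : (c.symm.trans c').source = c.target ∩ c.symm ⁻¹' c'.source :=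
    c.symm.trans_source c'
  have hy₀' := hsrc ▸ hy₀
  have hT : ∀ y ∈ (c.symm.trans c').source, ∃ (hy : y ∈ c.target)
      (hy' : c' (c.symm y) ∈ c'.target),
      g.frameProj V ⟨s' (c' (c.symm y)), h'.mem_frames _ hy'⟩ =
        g.frameProj U ⟨s y, h.mem_frames y hy⟩ := fun y hy => by
    have hy' := hsrc ▸ hy
    refine ⟨hy'.1, c'.map_source hy'.2, ?_⟩
    rw [h'.frameProj_eq _ (c'.map_source hy'.2), h.frameProj_eq _ hy'.1, c'.left_inv hy'.2]
  obtain ⟨h1, h2, h3⟩ := hT y₀ hy₀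
  set q₀ : g.frames V := ⟨s' (c' (c.symm y₀)), h'.mem_frames _ h2⟩ with hq₀
  obtain ⟨σ, hσ, h4, h5⟩ := g.frameProj_eq_frameProj_iff.1 h3.symm
  have hD : IsOpen {p : FrameSp n | p.1 ∈ σ.source} := σ.open_source.preimage continuous_fst
  have hsd : ContDiffAt ℝ ∞ s y₀ := h.contDiffOn.contDiffAt (c.open_target.mem_nhds h1)
  have hmd : ContDiffAt ℝ ∞ (fun y => frameMap σ (s y)) y₀ :=
    ((contDiffOn_frameMap σ.open_source hσ.contDiffOn).contDiffAt (hD.mem_nhds h4)).comp y₀ hsd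
  have hsd' : ContinuousAt (fun y => s' (c' (c.symm y))) y₀ :=
    ContinuousAt.comp (g := s')
      (h'.contDiffOn.continuousOn.continuousAt (c'.open_target.mem_nhds h2))
      ((c.symm.trans c').continuousAt hy₀)
  obtain ⟨P, hP, Q, hQ, hPQ⟩ := g.exists_nhds_forall_smul_ne (p := q₀) (q := q₀) {a | a ≠ 1}
    fun a ha h => ha (g.eq_one_of_smul_eq h).2
  obtain ⟨P', hP', hPP'⟩ := mem_nhds_subtype _ _ _ |>.1 hP
  obtain ⟨Q', hQ', hQQ'⟩ := mem_nhds_subtype _ _ _ |>.1 hQ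
  have hQ'' : Q' ∈ 𝓝 (frameMap σ (s y₀)) := h5 ▸ hQ'
  -- Both `s' ∘ c' ∘ c.symm` and `frameMap σ ∘ s` lift `c.symm` to frames over `V`, so they differ
  -- pointwise by a group element. They agree at `y₀`, and freeness excludes every nontrivial
  -- element nearby.
  have hev : (c.symm.trans c') =ᶠ[𝓝 y₀] fun y => π' (frameMap σ (s y)) := by
    filter_upwards [(c.symm.trans c').open_source.mem_nhds hy₀,
      hsd.continuousAt.eventually (hD.mem_nhds h4), hmd.continuousAt.eventually hQ'',
      hsd'.eventually hP'] with y hy hyσ hyQ hyP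
    obtain ⟨h6, h7, h8⟩ := hT y hy
    have h9 := hσ.frameProj_eq ⟨s y, h.mem_frames y h6⟩
      ⟨frameMap σ (s y), hσ.frameMap_mem (h.mem_frames y h6) hyσ⟩ hyσ rfl
    obtain ⟨a, ha⟩ := g.exists_smul_eq_of_frameProj_eq (h8.trans h9.symm)
    by_cases ha1 : a = 1
    · rw [ha1, one_smul] at ha
      have : s' (c' (c.symm y)) = frameMap σ (s y) := congrArg Subtype.val ha
      rw [← this, h'.left_inv _ h7]
      rfl
    · exact absurd ha (hPQ _ (hPP' hyP) _ (hQQ' hyQ) a ha1)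
  exact ((π'.contDiff.contDiffAt.comp y₀ hmd).congr_of_eventuallyEq hev).contDiffWithinAt

theorem exists_isFrameChart_mem_source (q : g.FrameBundle) :
    ∃ c : OpenPartialHomeomorph g.FrameBundle (EucSp (n + n.choose 2)), q ∈ c.source ∧
      ∃ U s π, g.IsFrameChart U s π c := by
  obtain ⟨U, p, rfl⟩ := g.exists_frameProj_eq q
  obtain ⟨e, h1, h2, s, π, c, h3, h4, -⟩ := g.exists_isFrameChart p
  refine ⟨c, ?_, U, s, π, h3⟩
  rw [h4, ← h2]
  exact e.map_source h1

/-- The charted space structure of the frame bundle. -/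
@[reducible] def chartedSpaceFrameBundle :
    ChartedSpace (EucSp (n + n.choose 2)) g.FrameBundle where
  atlas := {c | ∃ U s π, g.IsFrameChart U s π c}
  chartAt q := (g.exists_isFrameChart_mem_source q).choose
  mem_chart_source q := (g.exists_isFrameChart_mem_source q).choose_spec.1
  chart_mem_atlas q := (g.exists_isFrameChart_mem_source q).choose_spec.2

theorem isManifold_frameBundle :
    letI := g.chartedSpaceFrameBundle
    IsManifold (𝓡 (n + n.choose 2)) ∞ g.FrameBundle := by
  let := g.chartedSpaceFrameBundle
  refine isManifold_of_contDiffOn _ _ _ ?_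
  rintro c c' ⟨U, s, π, h⟩ ⟨V, s', π', h'⟩
  simpa using h.contDiffOn_transition h'

theorem isSubmanifoldLocalDiffeoAt_frameProj (p : g.frames U) :
    letI := g.chartedSpaceFrameBundle
    IsSubmanifoldLocalDiffeoAt (n + n.choose 2) (g.frameProj U) p := by
  let := g.chartedSpaceFrameBundle
  have := g.isManifold_frameBundle
  obtain ⟨e, h1, h2, s, π, c, h3, h4, h5⟩ := g.exists_isFrameChart p
  have hatlas : c ∈ atlas (EucSp (n + n.choose 2)) g.FrameBundle := ⟨U, s, π, h3⟩
  have hc : ContMDiffOn (𝓡 (n + n.choose 2)) (𝓡 (n + n.choose 2)) ∞ c c.source :=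
    contMDiffOn_of_mem_maximalAtlas (IsManifold.subset_maximalAtlas hatlas)
  have hsmooth : ContMDiffOn (𝓡 (n + n.choose 2)) 𝓘(ℝ, FrameSp n) ∞
      (fun y => (e.symm y : FrameSp n)) e.target := by
    rw [← h4] at h5 ⊢
    exact (h3.contDiffOn.contMDiffOn.comp hc fun q hq => c.map_source hq).congr
      fun q hq => (h5 q hq).symm
  refine ⟨e, h1, fun q _ => congrFun h2 q, hsmooth, fun q hq => ?_⟩
  have hq' : q ∈ c.source := h4 ▸ hq
  have hinj := (mdifferentiable_of_mem_atlas (I := 𝓡 (n + n.choose 2))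
    hatlas).mfderiv_injective hq'
  have hd : MDifferentiableAt (𝓡 (n + n.choose 2)) 𝓘(ℝ, FrameSp n)
      (fun y => (e.symm y : FrameSp n)) q :=
    (hsmooth.contMDiffAt (e.open_target.mem_nhds hq)).mdifferentiableAt (by simp)
  have hπ : MDifferentiableAt 𝓘(ℝ, FrameSp n) (𝓡 (n + n.choose 2)) π (e.symm q : FrameSp n) :=
    π.differentiableAt.mdifferentiableAt
  -- The chart factors through the inverse branch followed by a linear map. Since the chart has
  -- injective derivative, so does the branch.
  have hev : c =ᶠ[𝓝 q] π ∘ fun y => (e.symm y : FrameSp n) := by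
    filter_upwards [c.open_source.mem_nhds hq'] with z hz
    rw [Function.comp_apply, ← h5 z (h4 ▸ hz), h3.left_inv _ (c.map_source hz)]
  rw [hev.mfderiv_eq, mfderiv_comp q hπ hd] at hinj
  exact Function.Injective.of_comp hinj

end OrbifoldMetric

end

theorem mainTheorem12 (n : ℕ) (X : EffectiveOrbifold n) (𝒰 : OrbifoldAtlas n X.space)
    (h𝒰 : 𝒰.toStructure = X.str) (g : OrbifoldMetric 𝒰) :
    -- the frame bundle, with the charts `(g.frames U, U.G, g.frameProj U)`, is an effective orbifold
    (T2Space g.FrameBundle ∧ ParacompactSpace g.FrameBundle ∧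
      (∀ U : 𝒰.charts,
        IsOpenEmbedding (orbitSpaceMap U.1.G (g.frameProj U) (g.frameProj_smul U))) ∧
      (∀ U : 𝒰.charts, FaithfulSMul U.1.G (g.frames U)) ∧
      (∀ U V : 𝒰.charts, ∀ q ∈ range (g.frameProj U) ∩ range (g.frameProj V),
        ∃ W : 𝒰.charts, q ∈ range (g.frameProj W) ∧
          range (g.frameProj W) ⊆ range (g.frameProj U) ∩ range (g.frameProj V) ∧
          (∃ f, W.1.IsEmb U.1 f) ∧ (∃ f, W.1.IsEmb V.1 f))) ∧
    -- a group element fixing a frame has identity differential there and is trivial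
    (∀ (U : 𝒰.charts) (a : U.1.G) (p : g.frames U), a • p = p →
      fderiv ℝ (U.1.act a) p.1.1 = ContinuousLinearMap.id ℝ (EucSp n) ∧ a = 1) ∧
    -- the singular set is empty
    g.frameSingularSet = ∅ ∧
    -- the charts make the frame bundle a smooth manifold
    ∃ _ : ChartedSpace (EucSp (n + n.choose 2)) g.FrameBundle,
      IsManifold (𝓡 (n + n.choose 2)) ∞ g.FrameBundle ∧
      ∀ (U : 𝒰.charts) (p : g.frames U),
        IsSubmanifoldLocalDiffeoAt (n + n.choose 2) (g.frameProj U) p := by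
  refine ⟨⟨g.t2Space_frameBundle, g.paracompactSpace_frameBundle,
    g.isOpenEmbedding_orbitSpaceMap_frameProj, fun U => g.faithfulSMul_frames, ?_⟩,
    fun U a p h => g.eq_one_of_smul_eq h, g.frameSingularSet_eq_empty,
    g.chartedSpaceFrameBundle, g.isManifold_frameBundle,
    fun U p => g.isSubmanifoldLocalDiffeoAt_frameProj p⟩
  rintro U V q ⟨hqU, hqV⟩
  -- Chart images are preimages of base chart images, so a chart `W` chosen for the base point also
  -- works upstairs.
  simp only [g.range_frameProj] at hqU hqV ⊢
  obtain ⟨W, hW, h1, h2, h3, h4⟩ := 𝒰.compatible U.1 U.2 V.1 V.2 (g.baseProj q) ⟨hqU, hqV⟩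
  exact ⟨⟨W, hW⟩, h1, preimage_mono h2, h3, h4⟩
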